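/- For $m\ge 0$ let $U(m)$ be the unitary group, let $\mathbb T^n=(\mathbb S^1)^n$, and for $a,b$ in a group put $[a,b]=aba^{-1}b^{-1}$. For an $n\times n$ matrix $D=(d_{ij})$ with entries in $\mathbb R/\mathbb Z$ let $B_n(U(m))_D$ be the space of all $(A_1,\dots,A_n)\in U(m)^n$ whose pairwise commutators are central in $U(m)$ and satisfy $[A_i,A_j]=e^{2\pi\sqrt{-1}\,d_{ij}}I_m$ for all $i,j$; $U(m)$ acts on it by simultaneous conjugation. For $2t\le n$ and $d_1,\dots,d_t\in\mathbb R/\mathbb Z$ let $D_n(d_1,\dots,d_t)$ be the skew-symmetric $n\times n$ matrix with $(k+t,k)$ entry $d_k$, $(k,k+t)$ entry $-d_k$ for $1\le k\le t$, and all other entries $0$. Let $e_1,\dots,e_n$ be a basis of $\mathbb Z^n$ with dual basis $e_1^*,\dots,e_n^*$, let $2t\le n$, and let $c_1,\dots,c_t$ be positive integers with $c_i\mid c_{i+1}$ for $1\le i<t$. Let $1\to\mathbb Z\to\Gamma\to\mathbb Z^n\to 1$ be a central extension with k-invariant $\omega=c_1e_1^*\wedge e_{t+1}^*+\dots+c_te_t^*\wedge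 e_{2t}^*\in H^2(\mathbb Z^n;\mathbb Z)$, and let $x\in\Gamma$ be the image of $1\in\mathbb Z$. For a complex polynomial $p(z)$ let $U(m)_{p(z)}$ be the space of $X\in U(m)$ with characteristic polynomial $p(z)$, and let $\mathrm{Hom}(\Gamma,U(m))_{p(z)}$ be the space of homomorphisms $f:\Gamma\to U(m)$ such that $f(x)$ has characteristic polynomial $p(z)$ (with the topology of pointwise convergence). The group $U(m)$ acts on both by conjugation, and $\mathrm{res}:\mathrm{Hom}(\Gamma,U(m))_{p(z)}\to U(m)_{p(z)}$, $f\mapsto f(x)$, is restriction to the central subgroup $\mathbb Z$. Let $p(z)=\prod_{j=1}^s(z-\lambda_j)^{m_j}$ with distinct roots $\lambda_1,\dots,\lambda_s\in\mathbb S^1$ and multiplicities $m_j\ge 1$; let $m=\sum_j m_j$, let $q_j=\frac1{2\pi\sqrt{-1}}\log\lambda_j\in\mathbb R/\mathbb Z$, and embed $\prod_jU(m_j)$ in $U(m)$ as block diagonal matrices. Then: 1. There are $U(m)$-equivariant homeomorphisms \[\mathrm{Hom}(\Gamma,U(m))_{p(z)}\cong U(m)\times_{\prod_jU(m_j)}\prod_{j=1}^s\mathrm{Hom}(\Gamma,U(m_j))_{(z-\lambda_j)^{m_j}}\cong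 U(m)\times_{\prod_jU(m_j)}\prod_{j=1}^sB_n(U(m_j))_{D_n(-c_1q_j,\dots,-c_tq_j)}\] and $U(m)_{p(z)}\cong U(m)/\prod_jU(m_j)$ (a flag manifold), under which $\mathrm{res}$ corresponds to the map collapsing the factor $\prod_j\mathrm{Hom}(\Gamma,U(m_j))_{(z-\lambda_j)^{m_j}}$, respectively $\prod_jB_n(U(m_j))_{D_n(-c_1q_j,\dots,-c_tq_j)}$, to a point. 2. The map $\mathrm{res}$ is a locally trivial fibre bundle over the flag manifold $U(m)_{p(z)}$, with fibre $\prod_j\mathrm{Hom}(\Gamma,U(m_j))_{(z-\lambda_j)^{m_j}}$, and also with fibre $\prod_jB_n(U(m_j))_{D_n(-c_1q_j,\dots,-c_tq_j)}$. 3. Suppose moreover that each $\lambda_j$ is a primitive $k_j$-th root of unity and that $\mathrm{Hom}(\Gamma,U(m))_{p(z)}$ is non-empty. Then $\prod_{i=1}^tk_j/(k_j,c_i)$ divides $m_j$ for every $j$, where $(k_j,c_i)$ is the greatest common divisor, and with $l_j=m_j/\prod_{i=1}^t\bigl(k_j/(k_j,c_i)\bigr)$ the orbit space $\mathrm{Hom}(\Gamma,U(m))_{p(z)}/U(m)$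 is homeomorphic to $\prod_{j=1}^s(\mathbb T^n)^{l_j}/\Sigma_{l_j}$, where the symmetric group $\Sigma_{l_j}$ permutes the factors. -/

import Mathlib

open scoped BigOperators

noncomputable section

namespace RankOne

universe u

/-! ### Central extensions by `ℤ` and their k-invariants -/

section KInvariant

variable {G : Type} [Group G] {Γ : Type u} [Group Γ]

/-- The extension `1 → ℤ → Γ → G → 1` is central. -/
def IsCentral (S : GroupExtension (Multiplicative ℤ) Γ G) : Prop :=
  S.inl.range ≤ Subgroup.center Γ

theorem exists_factor (S : GroupExtension (Multiplicative ℤ) Γ G) (σ : S.Section) (g h : G) :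
    ∃ z : Multiplicative ℤ, S.inl z = σ g * σ h * (σ (g * h))⁻¹ := by
  have : σ g * σ h * (σ (g * h))⁻¹ ∈ S.inl.range := by
    rw [S.range_inl_eq_ker_rightHom, MonoidHom.mem_ker]
    simp
  exact this

/-- The factor set `f` of a set-theoretic section `σ`: `σ g * σ h = f (g, h) * σ (g * h)`. -/
def factorSet (S : GroupExtension (Multiplicative ℤ) Γ G) (σ : S.Section) : G × G → ℤ :=
  fun gh => Multiplicative.toAdd (Classical.choose (exists_factor S σ gh.1 gh.2))

theorem factorSet_spec (S : GroupExtension (Multiplicative ℤ) Γ G) (σ : S.Section) (g h : G) :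
    σ g * σ h = S.inl (Multiplicative.ofAdd (factorSet S σ (g, h))) * σ (g * h) := by
  have := Classical.choose_spec (exists_factor S σ g h)
  simp only [factorSet, ofAdd_toAdd]
  rw [this]
  simp

theorem factorSet_mem_cocycles₂ (S : GroupExtension (Multiplicative ℤ) Γ G) (hS : IsCentral S)
    (σ : S.Section) :
    (factorSet S σ : G × G → Rep.trivial ℤ G ℤ) ∈
      groupCohomology.cocycles₂ (Rep.trivial ℤ G ℤ) := by
  rw [groupCohomology.mem_cocycles₂_iff]
  intro g h j
  have hc : ∀ (z : Multiplicative ℤ) (y : Γ), y * S.inl z = S.inl z * y := fun z y =>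
    Subgroup.mem_center_iff.1 (hS ⟨z, rfl⟩) y
  change factorSet S σ (g * h, j) + factorSet S σ (g, h) =
    factorSet S σ (h, j) + factorSet S σ (g, h * j)
  apply Multiplicative.ofAdd.injective
  apply S.inl_injective
  apply mul_right_cancel (b := σ (g * h * j))
  have h1 : σ g * σ h * σ j = S.inl (Multiplicative.ofAdd (factorSet S σ (g * h, j) +
      factorSet S σ (g, h))) * σ (g * h * j) := by
    rw [factorSet_spec S σ g h, mul_assoc, factorSet_spec S σ (g * h) j, ← mul_assoc, ← map_mul,
      ← ofAdd_add, add_comm]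
  have h2 : σ g * (σ h * σ j) = S.inl (Multiplicative.ofAdd (factorSet S σ (h, j) +
      factorSet S σ (g, h * j))) * σ (g * h * j) := by
    rw [factorSet_spec S σ h j, ← mul_assoc, hc, mul_assoc, factorSet_spec S σ g (h * j),
      ← mul_assoc, ← map_mul, ← ofAdd_add, mul_assoc g h j]
  rw [← h1, ← h2, mul_assoc]

/-- The class in `H²(G; ℤ)` (trivial coefficients) of the factor set of a section. -/
def factorSetClass (S : GroupExtension (Multiplicative ℤ) Γ G) (hS : IsCentral S)
    (σ : S.Section) : groupCohomology.H2 (Rep.trivial ℤ G ℤ) :=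
  groupCohomology.H2π (Rep.trivial ℤ G ℤ) ⟨factorSet S σ, factorSet_mem_cocycles₂ S hS σ⟩

/-- The k-invariant of a central extension `1 → ℤ → Γ → G → 1`: the class in `H²(G; ℤ)` of the
factor set of a section. -/
def kInvariant (S : GroupExtension (Multiplicative ℤ) Γ G) (hS : IsCentral S) :
    groupCohomology.H2 (Rep.trivial ℤ G ℤ) :=
  factorSetClass S hS ⟨Function.surjInv S.rightHom_surjective,
    Function.rightInverse_surjInv S.rightHom_surjective⟩

/-- The k-invariant does not depend on the section. -/
theorem kInvariant_eq (S : GroupExtension (Multiplicative ℤ) Γ G) (hS : IsCentral S)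
    (σ : S.Section) : kInvariant S hS = factorSetClass S hS σ := by
  unfold kInvariant
  generalize (⟨Function.surjInv S.rightHom_surjective,
    Function.rightInverse_surjInv S.rightHom_surjective⟩ : S.Section) = τ
  have hc : ∀ (z : Multiplicative ℤ) (y : Γ), y * S.inl z = S.inl z * y := fun z y =>
    Subgroup.mem_center_iff.1 (hS ⟨z, rfl⟩) y
  have hb : ∀ g, ∃ z : Multiplicative ℤ, S.inl z = τ g * (σ g)⁻¹ := by
    intro g
    have : τ g * (σ g)⁻¹ ∈ S.inl.range := by
      rw [S.range_inl_eq_ker_rightHom, MonoidHom.mem_ker]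
      simp
    exact this
  choose b hb using hb
  have hb' : ∀ g, τ g = S.inl (b g) * σ g := fun g => by rw [hb]; simp
  rw [factorSetClass, factorSetClass, groupCohomology.H2π_eq_iff]
  refine ⟨fun g => Multiplicative.toAdd (b g), ?_⟩
  funext gh
  obtain ⟨g, h⟩ := gh
  change Multiplicative.toAdd (b h) - Multiplicative.toAdd (b (g * h)) +
    Multiplicative.toAdd (b g) = factorSet S τ (g, h) - factorSet S σ (g, h)
  have key : Multiplicative.ofAdd (factorSet S τ (g, h)) * b (g * h) =
      b g * b h * Multiplicative.ofAdd (factorSet S σ (g, h)) := by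
    apply S.inl_injective
    apply mul_right_cancel (b := σ (g * h))
    have e1 := factorSet_spec S τ g h
    rw [hb' (g * h)] at e1
    rw [map_mul, mul_assoc, ← e1, hb' g, hb' h, map_mul, map_mul, mul_assoc _ _ (σ (g * h)),
      ← factorSet_spec S σ g h, mul_assoc, ← mul_assoc (σ g), hc, mul_assoc, mul_assoc]
  have := congrArg Multiplicative.toAdd key
  simp only [toAdd_mul, toAdd_ofAdd] at this
  linarith

end KInvariant

section Wedge

variable {n t : ℕ}

/-- The bilinear 2-cocycle `(x, y) ↦ ∑ₖ cₖ eₖ*(x) e_{t+k}*(y)` on `ℤⁿ`, where `e*` is the basis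
dual to `e`. -/
def wedgeCochain (e : Module.Basis (Fin n) ℤ (Fin n → ℤ)) (ht : 2 * t ≤ n) (c : Fin t → ℕ) :
    Multiplicative (Fin n → ℤ) × Multiplicative (Fin n → ℤ) → ℤ :=
  fun xy => ∑ k : Fin t, (c k : ℤ) *
    (e.coord ⟨k, by omega⟩ (Multiplicative.toAdd xy.1) *
      e.coord ⟨t + k, by omega⟩ (Multiplicative.toAdd xy.2))

theorem wedgeCochain_mem_cocycles₂ (e : Module.Basis (Fin n) ℤ (Fin n → ℤ)) (ht : 2 * t ≤ n)
    (c : Fin t → ℕ) :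
    (wedgeCochain e ht c : _ → Rep.trivial ℤ (Multiplicative (Fin n → ℤ)) ℤ) ∈
      groupCohomology.cocycles₂ (Rep.trivial ℤ (Multiplicative (Fin n → ℤ)) ℤ) := by
  rw [groupCohomology.mem_cocycles₂_iff]
  intro g h j
  change wedgeCochain e ht c (g * h, j) + wedgeCochain e ht c (g, h) =
    wedgeCochain e ht c (h, j) + wedgeCochain e ht c (g, h * j)
  simp only [wedgeCochain, toAdd_mul, map_add, ← Finset.sum_add_distrib]
  exact Finset.sum_congr rfl fun k _ => by ring

/-- The class `c₁ e₁* ∧ e_{t+1}* + ⋯ + c_t e_t* ∧ e_{2t}*` in `H²(ℤⁿ; ℤ)`; the product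
`eᵢ* ∧ eⱼ*` of two degree one classes is represented by `(x, y) ↦ eᵢ*(x) eⱼ*(y)`. -/
def wedgeClass (e : Module.Basis (Fin n) ℤ (Fin n → ℤ)) (ht : 2 * t ≤ n) (c : Fin t → ℕ) :
    groupCohomology.H2 (Rep.trivial ℤ (Multiplicative (Fin n → ℤ)) ℤ) :=
  groupCohomology.H2π (Rep.trivial ℤ (Multiplicative (Fin n → ℤ)) ℤ)
    ⟨wedgeCochain e ht c, wedgeCochain_mem_cocycles₂ e ht c⟩

end Wedge

/-! ### Unitary groups and spaces of homomorphisms -/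

/-- The unitary group `U(m)`. -/
abbrev U (m : ℕ) : Type := Matrix.unitaryGroup (Fin m) ℂ

/-- `Hom(Γ, U(m))` with the topology of pointwise convergence; if `Γ` is generated by a finite
family, this is the subspace topology of a finite power of `U(m)`. -/
instance homTopology (Γ : Type u) [Group Γ] (m : ℕ) : TopologicalSpace (Γ →* U m) :=
  TopologicalSpace.induced (fun (f : Γ →* U m) (γ : Γ) => f γ) inferInstance

theorem charpoly_conj {m : ℕ} (g X : U m) :
    ((g * X * g⁻¹ : U m) : Matrix (Fin m) (Fin m) ℂ).charpoly =
      (X : Matrix (Fin m) (Fin m) ℂ).charpoly := by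
  have h1 : ((g⁻¹ : U m) : Matrix (Fin m) (Fin m) ℂ) * (g : Matrix (Fin m) (Fin m) ℂ) = 1 := by
    rw [← Submonoid.coe_mul, inv_mul_cancel, Submonoid.coe_one]
  rw [Submonoid.coe_mul, Matrix.charpoly_mul_comm, Submonoid.coe_mul, ← mul_assoc, h1, one_mul]

/-- `U(m)_{p(z)}`: unitary matrices with characteristic polynomial `p`. -/
def UP (m : ℕ) (p : Polynomial ℂ) : Type :=
  {X : U m // (X : Matrix (Fin m) (Fin m) ℂ).charpoly = p}

instance (m : ℕ) (p : Polynomial ℂ) : TopologicalSpace (UP m p) := instTopologicalSpaceSubtype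

/-- `U(m)` acts on `U(m)_{p(z)}` by conjugation. -/
instance (m : ℕ) (p : Polynomial ℂ) : MulAction (U m) (UP m p) where
  smul g X := ⟨g * X.1 * g⁻¹, (charpoly_conj g X.1).trans X.2⟩
  one_smul X := Subtype.ext (by change 1 * X.1 * 1⁻¹ = X.1; simp)
  mul_smul g h X := Subtype.ext (by
    change g * h * X.1 * (g * h)⁻¹ = g * (h * X.1 * h⁻¹) * g⁻¹
    group)

/-- `Hom(Γ, U(m))_{p(z)}`: homomorphisms `f` such that `f x` has characteristic polynomial `p`;
here `x` is the generator of the central subgroup `ℤ`. -/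
def HomP (Γ : Type u) [Group Γ] (x : Γ) (m : ℕ) (p : Polynomial ℂ) : Type u :=
  {f : Γ →* U m // (f x : Matrix (Fin m) (Fin m) ℂ).charpoly = p}

section HomP

variable (Γ : Type u) [Group Γ] (x : Γ) (m : ℕ) (p : Polynomial ℂ)

instance : TopologicalSpace (HomP Γ x m p) := instTopologicalSpaceSubtype

/-- `U(m)` acts on `Hom(Γ, U(m))_{p(z)}` by conjugation: `(g • f) γ = g * f γ * g⁻¹`. -/
instance : MulAction (U m) (HomP Γ x m p) where
  smul g f := ⟨(MulAut.conj g).toMonoidHom.comp f.1, (charpoly_conj g (f.1 x)).trans f.2⟩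
  one_smul f := Subtype.ext (MonoidHom.ext fun γ => by
    change 1 * f.1 γ * 1⁻¹ = f.1 γ
    simp)
  mul_smul g h f := Subtype.ext (MonoidHom.ext fun γ => by
    change g * h * f.1 γ * (g * h)⁻¹ = g * (h * f.1 γ * h⁻¹) * g⁻¹
    group)

/-- Restriction to the central subgroup generated by `x`, as a map
`Hom(Γ, U(m))_{p(z)} → U(m)_{p(z)}`. -/
def res (f : HomP Γ x m p) : UP m p := ⟨f.1 x, f.2⟩

end HomP

/-! ### Almost commuting tuples -/

section AlmostCommuting

variable {n m : ℕ}

/-- The commutator `[a, b] = a b a⁻¹ b⁻¹`. -/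
def comm (a b : U m) : U m := a * b * a⁻¹ * b⁻¹

/-- `A ∈ B_n(U(m))`: all commutators `[A i, A j]` are central in `U(m)`. -/
def IsAlmostCommuting (A : Fin n → U m) : Prop :=
  ∀ i j, comm (A i) (A j) ∈ Subgroup.center (U m)

/-- `A` is `D`-commuting: `[A i, A j] = exp(2π√-1 d_{ij}) I` for all `i, j`. -/
def IsDCommuting (D : Matrix (Fin n) (Fin n) UnitAddCircle) (A : Fin n → U m) : Prop :=
  ∀ i j, (comm (A i) (A j) : Matrix (Fin m) (Fin m) ℂ) =
    ((AddCircle.toCircle (D i j) : Circle) : ℂ) • (1 : Matrix (Fin m) (Fin m) ℂ)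

/-- The space `B_n(U(m))_D` of `D`-commuting almost commuting tuples, for a matrix `D` with
entries in `ℝ/ℤ ⊇ ℚ/ℤ`. -/
def BD (m : ℕ) (D : Matrix (Fin n) (Fin n) UnitAddCircle) : Type :=
  {A : Fin n → U m // IsAlmostCommuting A ∧ IsDCommuting D A}

instance (D : Matrix (Fin n) (Fin n) UnitAddCircle) : TopologicalSpace (BD m D) :=
  instTopologicalSpaceSubtype

theorem commutator_conj (g a b : U m) :
    comm (g * a * g⁻¹) (g * b * g⁻¹) = g * comm a b * g⁻¹ := by
  simp only [comm]
  group

theorem conj_eq_of_mem_center {z : U m} (hz : z ∈ Subgroup.center (U m)) (g : U m) :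
    g * z * g⁻¹ = z := by
  rw [Subgroup.mem_center_iff.1 hz g]
  simp

/-- `U(m)` acts on `B_n(U(m))_D` by simultaneous conjugation. -/
instance (D : Matrix (Fin n) (Fin n) UnitAddCircle) : MulAction (U m) (BD m D) where
  smul g A := ⟨fun i => g * A.1 i * g⁻¹,
    fun i j => by
      rw [commutator_conj, conj_eq_of_mem_center (A.2.1 i j)]
      exact A.2.1 i j,
    fun i j => by
      rw [commutator_conj, conj_eq_of_mem_center (A.2.1 i j)]
      exact A.2.2 i j⟩
  one_smul A := Subtype.ext (funext fun i => by
    change 1 * A.1 i * 1⁻¹ = A.1 i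
    simp)
  mul_smul g h A := Subtype.ext (funext fun i => by
    change g * h * A.1 i * (g * h)⁻¹ = g * (h * A.1 i * h⁻¹) * g⁻¹
    group)

/-- The skew-symmetric matrix `D_n(d₁, …, d_t)`: its `(k + t, k)` entry is `d_k`, its `(k, k + t)`
entry is `-d_k`, and all other entries vanish. -/
def Dmat (n : ℕ) {t : ℕ} (d : Fin t → UnitAddCircle) : Matrix (Fin n) (Fin n) UnitAddCircle :=
  fun i j =>
    if h : j.val < t ∧ i.val = j.val + t then d ⟨j.val, h.1⟩
    else if h : i.val < t ∧ j.val = i.val + t then -d ⟨i.val, h.1⟩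
    else 0

/-- `q = (1 / 2π√-1) log z ∈ ℝ/ℤ` for `z` on the unit circle; there `log z = √-1 arg z`. -/
def logQ (z : Circle) : UnitAddCircle :=
  ((Complex.arg (z : ℂ) / (2 * Real.pi) : ℝ) : UnitAddCircle)

end AlmostCommuting

/-! ### Balanced products, block sums, symmetric products -/

section Balanced

variable {G H : Type*} [Group G] [Group H]

/-- The relation `(g h⁻¹, h y) ∼ (g, y)` on `G × F`. -/
def balancedSetoid (ι : H →* G) (F : Type*) [MulAction H F] : Setoid (G × F) where
  r a b := ∃ h : H, b = (a.1 * (ι h)⁻¹, h • a.2)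
  iseqv :=
    { refl := fun a => ⟨1, by simp⟩
      symm := by
        rintro a b ⟨h, rfl⟩
        exact ⟨h⁻¹, by simp⟩
      trans := by
        rintro a b c ⟨h, rfl⟩ ⟨k, rfl⟩
        exact ⟨k * h, by simp [mul_smul, mul_assoc]⟩ }

/-- The balanced product `G ×_H F`, where `H` acts on `G` through `ι : H → G`. -/
def BalancedProduct (ι : H →* G) (F : Type*) [MulAction H F] : Type _ :=
  Quotient (balancedSetoid ι F)

variable (ι : H →* G) (F : Type*) [MulAction H F]

instance [TopologicalSpace G] [TopologicalSpace F] : TopologicalSpace (BalancedProduct ι F) :=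
  instTopologicalSpaceQuotient

/-- `G` acts on `G ×_H F` by left multiplication on the first factor. -/
instance : MulAction G (BalancedProduct ι F) where
  smul g := Quotient.map (fun a => (g * a.1, a.2)) (by
    rintro a b ⟨h, rfl⟩
    exact ⟨h, by simp [mul_assoc]⟩)
  one_smul a := by
    induction a using Quotient.inductionOn with
    | h a => exact congrArg (Quotient.mk _) (by simp)
  mul_smul g k a := by
    induction a using Quotient.inductionOn with
    | h a => exact congrArg (Quotient.mk _) (by simp [mul_assoc])

/-- The map `G ×_H F → G/H` collapsing `F` to a point. -/
def collapse : BalancedProduct ι F → G ⧸ ι.range :=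
  Quotient.lift (fun a => (QuotientGroup.mk a.1 : G ⧸ ι.range)) (by
    rintro a b ⟨h, rfl⟩
    refine QuotientGroup.eq.2 ⟨h⁻¹, ?_⟩
    simp)

end Balanced

/-- The inclusion `∏ⱼ U(mⱼ) → U(∑ⱼ mⱼ)` by block diagonal matrices. -/
def blockEmb {s : ℕ} (mu : Fin s → ℕ) : (∀ j, U (mu j)) →* U (∑ j, mu j) where
  toFun M := ⟨Matrix.reindex finSigmaFinEquiv finSigmaFinEquiv
      (Matrix.blockDiagonal' fun j => (M j : Matrix (Fin (mu j)) (Fin (mu j)) ℂ)), by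
    rw [Matrix.mem_unitaryGroup_iff, Matrix.star_eq_conjTranspose, Matrix.conjTranspose_reindex,
      Matrix.blockDiagonal'_conjTranspose, Matrix.reindex_apply, Matrix.reindex_apply,
      Matrix.submatrix_mul_equiv, ← Matrix.blockDiagonal'_mul]
    have : ∀ j, (M j : Matrix (Fin (mu j)) (Fin (mu j)) ℂ) *
        (M j : Matrix (Fin (mu j)) (Fin (mu j)) ℂ).conjTranspose = 1 := fun j =>
      Matrix.mem_unitaryGroup_iff.1 (M j).2
    simp only [this]
    have h1 : Matrix.blockDiagonal' (fun j => (1 : Matrix (Fin (mu j)) (Fin (mu j)) ℂ)) = 1 :=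
      Matrix.blockDiagonal'_one
    rw [h1, Matrix.submatrix_one_equiv]⟩
  map_one' := Subtype.ext (by
    have h1 : Matrix.blockDiagonal' (fun j => (1 : Matrix (Fin (mu j)) (Fin (mu j)) ℂ)) = 1 :=
      Matrix.blockDiagonal'_one
    simp [h1])
  map_mul' M N := Subtype.ext (by
    simp [Matrix.blockDiagonal'_mul, Matrix.submatrix_mul_equiv])

/-- Two `l`-tuples agree up to a permutation of the entries. -/
def symSetoid (l : ℕ) (X : Type*) : Setoid (Fin l → X) where
  r a b := ∃ τ : Equiv.Perm (Fin l), b = a ∘ τ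
  iseqv :=
    { refl := fun _ => ⟨1, rfl⟩
      symm := by
        rintro a b ⟨τ, rfl⟩
        exact ⟨τ⁻¹, by funext i; simp⟩
      trans := by
        rintro a b c ⟨τ, rfl⟩ ⟨υ, rfl⟩
        exact ⟨τ * υ, by funext i; simp⟩ }

/-- The symmetric product `X^l / Σ_l`. -/
def SymProd (l : ℕ) (X : Type*) : Type _ := Quotient (symSetoid l X)

instance (l : ℕ) (X : Type*) [TopologicalSpace X] : TopologicalSpace (SymProd l X) :=
  instTopologicalSpaceQuotient

/-- `f : E → B` is a (locally trivial) fibre bundle with fibre `F`. -/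
def IsFibreBundle (F : Type*) {E B : Type*} [TopologicalSpace F] [TopologicalSpace E]
    [TopologicalSpace B] (f : E → B) : Prop :=
  ∀ b : B, ∃ T : Bundle.Trivialization F f, b ∈ T.baseSet

end RankOne

end

open RankOne

/-!
The group `Γ` has normal forms `x ^ z * s u` with `z : ℤ` and `u : ℤⁿ`, where `x` is central and
the section `s` multiplies with the bilinear factor set `wform`: since the k-invariant is the given
wedge class, the factor set of any section differs from `wform` by a coboundary, which is absorbed
into the section (`exists_isNormalForm`). Hence homomorphisms out of `Γ` are maps on `ℤⁿ` that are
multiplicative up to powers of a central element, and evaluation on the lifted basis vectors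
identifies the homomorphisms with `f x = λ` with the almost commuting tuples for
`D_n(-c₁ q, …, -c_t q)` (`IsNormalForm.homeoBD`).

*Balanced products and bundles.* As `x` is central, `f γ` preserves the eigenspaces of `f x` for
every `f` and `γ`. After a conjugation that makes `f x` block scalar, `f` is a block sum of
homomorphisms on which `x` acts by the scalars `λⱼ`, and the conjugating element is unique up to
block diagonal matrices, the centralizer of the block scalar matrix. This is the balanced product
decomposition (`balancedHomeo`, `flagHomeo`); the bijections are homeomorphisms because all spaces
are compact Hausdorff. Near a given `X₀`, the spectral projections of `X ∈ U(m)_p` are polynomials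
in `X`. They carry an eigenbasis of `X₀` to the columns of an invertible matrix, whose unitary polar
factor depends continuously on `X` and conjugates the block scalar matrix to `X`; this is a local
section of `U(m) → U(m)_p` (`exists_local_section`), and it trivializes the restriction map
(`isFibreBundle_res`).

*Orbit spaces.* If `λ` is a primitive `k`-th root of unity, then `f ∘ s` is a projective
representation of `ℤⁿ` whose multiplier takes values in the `k`-th roots of unity. With
`N i = k / gcd k (c i)`, the order of `λ ^ c i`, and `R = ∏ᵢ ZMod (N i)`, every such representation
is a sum of copies of the functions on `R`, where `R` acts by translation and its dual by
multiplication, twisted by characters of `ℤⁿ` (`exists_conj_stdU`). So `∏ᵢ N i` divides the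
dimension, and the representation is given by `l` points of the torus, in no particular order. Two
parameters give conjugate representations exactly if they agree up to a permutation after raising
the coordinates to the powers `torusExp` (`stdHom_conj_iff`): these powers are the eigenvalues of
diagonal elements, and the converse is an explicit intertwiner. As raising to a power is a quotient
map of the circle onto itself, the orbit space is the product of the symmetric products of tori
(`orbitSpace_homeomorph`).
-/

noncomputable section

namespace RankOne


/-! ### Projective representations of Heisenberg type -/

section Heisenberg

/-- A character of a subgroup of an abelian group, with values in the divisible group `Circle`,
extends to the whole group. -/
theorem exists_addChar_extension {L : Type*} [AddCommGroup L] (K : AddSubgroup L)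
    (χ : AddChar K Circle) : ∃ α : AddChar L Circle, ∀ k : K, α k = χ k := by
  let f : K →+ UnitAddCircle :=
    { toFun := fun k => (AddCircle.homeomorphCircle (one_ne_zero' ℝ)).symm (χ k)
      map_zero' := by
        rw [Homeomorph.symm_apply_eq]; simp [AddCircle.homeomorphCircle_apply]
      map_add' := fun a b => by
        rw [Homeomorph.symm_apply_eq, AddCircle.homeomorphCircle_apply, AddCircle.toCircle_add,
          ← AddCircle.homeomorphCircle_apply one_ne_zero,
          ← AddCircle.homeomorphCircle_apply one_ne_zero, Homeomorph.apply_symm_apply,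
          Homeomorph.apply_symm_apply, AddChar.map_add_eq_mul] }
  obtain ⟨h, hh⟩ := (Module.Baer.of_divisible UnitAddCircle).extension_property_addMonoidHom
    K.subtype K.subtype_injective f
  refine ⟨⟨fun l => AddCircle.toCircle (h l), by simp, fun a b => by
    rw [map_add, AddCircle.toCircle_add]⟩, fun k => ?_⟩
  have h1 : h k = f k := DFunLike.congr_fun hh k
  change AddCircle.toCircle (h k) = χ k
  rw [h1, ← AddCircle.homeomorphCircle_apply one_ne_zero]
  exact Homeomorph.apply_symm_apply _ _

theorem inner_circle_smul {E : Type*} [NormedAddCommGroup E] [InnerProductSpace ℂ E]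
    (a b : Circle) (x y : E) :
    inner ℂ ((a : ℂ) • x) ((b : ℂ) • y) = ((a⁻¹ * b : Circle) : ℂ) * inner ℂ x y := by
  rw [inner_smul_left, inner_smul_right, Circle.coe_mul, Circle.coe_inv_eq_conj, mul_assoc]

variable {E : Type*} [NormedAddCommGroup E] [InnerProductSpace ℂ E] [FiniteDimensional ℂ E]

/-- By induction on the dimension: either all operators are scalar on `W`, or an eigenspace of one of
them cuts out a smaller invariant subspace. -/
theorem exists_common_eigenvector {ι : Type*} (f : ι → E →ₗ[ℂ] E)
    (hf : ∀ i j v, f i (f j v) = f j (f i v)) (W : Submodule ℂ E) (hW : W ≠ ⊥)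
    (hinv : ∀ i, ∀ v ∈ W, f i v ∈ W) : ∃ v ∈ W, v ≠ 0 ∧ ∀ i, ∃ c : ℂ, f i v = c • v := by
  induction hd : Module.finrank ℂ W using Nat.strong_induction_on generalizing W with
  | _ d ih =>
  subst hd
  by_cases hs : ∀ i, ∃ c : ℂ, ∀ v ∈ W, f i v = c • v
  · obtain ⟨v, hv, hv0⟩ := W.ne_bot_iff.1 hW
    exact ⟨v, hv, hv0, fun i => (hs i).imp fun c h => h v hv⟩
  · push Not at hs
    obtain ⟨i, hi⟩ := hs
    have : Nontrivial W := (Submodule.nontrivial_iff_ne_bot).2 hW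
    obtain ⟨c, hc⟩ := Module.End.exists_eigenvalue ((f i).restrict (hinv i))
    obtain ⟨⟨w, hw⟩, hw2⟩ := hc.exists_hasEigenvector
    have hwe : f i w = c • w := congrArg Subtype.val hw2.apply_eq_smul
    have hw0 : w ≠ 0 := fun h => hw2.2 (Subtype.ext h)
    have hlt : W ⊓ Module.End.eigenspace (f i) c < W := by
      refine lt_of_le_of_ne inf_le_left fun h => ?_
      obtain ⟨v, hv, hne⟩ := hi c
      rw [← h] at hv
      exact hne (Module.End.mem_eigenspace_iff.1 hv.2)
    obtain ⟨v, hv, h0, h1⟩ := ih _ (Submodule.finrank_lt_finrank_of_lt hlt)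
      (W ⊓ Module.End.eigenspace (f i) c)
      ((Submodule.ne_bot_iff _).2 ⟨w, ⟨hw, Module.End.mem_eigenspace_iff.2 hwe⟩, hw0⟩)
      (fun j v hv => ⟨hinv j v hv.1, Module.End.mem_eigenspace_iff.2 (by
        rw [hf, Module.End.mem_eigenspace_iff.1 hv.2, map_smul])⟩) rfl
    exact ⟨v, hv.1, h0, h1⟩

variable {L R : Type*} [AddCommGroup L] [AddCommGroup R]
  (sh : L →+ R) (ψ : AddChar L (AddChar R Circle))

/-- A projective unitary representation `T` of `L` with cocycle `(u, v) ↦ ψ u (sh v)`. -/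
structure IsProjRep (T : L → E →ₗ[ℂ] E) : Prop where
  zero_apply : ∀ x, T 0 x = x
  mul : ∀ u v x, T u (T v x) = (ψ u (sh v) : ℂ) • T (u + v) x
  isometry : ∀ u x y, inner ℂ (T u x) (T u y) = inner ℂ x y

variable {sh ψ}

/-- An invariant subspace of a projective representation contains a copy of the standard
irreducible representation on `ℂ[R]`, up to a twist by a character `α` of `L`: on `ker sh` the
operators commute, and a common eigenvector of these generates it. -/
theorem IsProjRep.exists_irreducible {T : L → E →ₗ[ℂ] E} (hT : IsProjRep sh ψ T)
    (hsurj : Function.Surjective sh)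
    (hsep : ∀ r r', (∀ u, sh u = 0 → ψ u r = ψ u r') → r = r')
    (W : Submodule ℂ E) (hW : W ≠ ⊥) (hinv : ∀ u, ∀ v ∈ W, T u v ∈ W) :
    ∃ (α : AddChar L Circle) (b : R → E), Orthonormal ℂ b ∧ (∀ r, b r ∈ W) ∧
      ∀ u r, T u (b r) = ((α u * ψ u r : Circle) : ℂ) • b (r + sh u) := by
  obtain ⟨v', hv', hv0', he'⟩ := exists_common_eigenvector (fun u : sh.ker => T u)
    (fun u v x => by
      have hu : sh u = 0 := u.2
      have hv : sh v = 0 := v.2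
      simp only [hT.mul, hu, hv, add_comm (u : L), AddChar.map_zero_eq_one]) W hW
    fun u => hinv u
  -- normalise the eigenvector
  obtain ⟨v, hv, hv1, he⟩ : ∃ v ∈ W, ‖v‖ = 1 ∧ ∀ u : sh.ker, ∃ c : ℂ, T u v = c • v := by
    refine ⟨((‖v'‖ : ℂ)⁻¹) • v', W.smul_mem _ hv', ?_, fun u => ?_⟩
    · rw [norm_smul, norm_inv, Complex.norm_real, norm_norm,
        inv_mul_cancel₀ (norm_ne_zero_iff.2 hv0')]
    · obtain ⟨c, hc⟩ := he' u
      exact ⟨c, by rw [map_smul, hc, smul_comm]⟩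
  have hv0 : v ≠ 0 := by rintro rfl; simp at hv1
  have hnorm : ∀ u x, ‖T u x‖ = ‖x‖ := fun u x => by
    rw [@norm_eq_sqrt_re_inner ℂ, @norm_eq_sqrt_re_inner ℂ, hT.isometry]
  have he2 : ∀ u : sh.ker, ∃ c : Circle, T u v = (c : ℂ) • v := fun u => by
    obtain ⟨c, hc⟩ := he u
    refine ⟨⟨c, ?_⟩, hc⟩
    have := hnorm u v
    rw [hc, norm_smul, hv1, mul_one] at this
    simp [Submonoid.unitSphere, this]
  choose χ hχ using he2
  have hinj : ∀ a b : Circle, (a : ℂ) • v = (b : ℂ) • v → a = b := fun a b h =>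
    Circle.ext (smul_left_injective ℂ hv0 h)
  obtain ⟨α, hα⟩ := exists_addChar_extension sh.ker
    ⟨χ, hinj _ _ (by rw [← hχ]; simp [hT.zero_apply]), fun a b => hinj _ _ (by
      have hb : sh b = 0 := b.2
      have := hT.mul a b v
      rw [hb, AddChar.map_zero_eq_one] at this
      rw [← hχ, AddSubgroup.coe_add, ← one_smul ℂ (T (a + b : L) v), ← Circle.coe_one, ← this, hχ,
        map_smul, hχ, smul_smul, Circle.coe_mul, mul_comm])⟩
  replace hα : ∀ k : sh.ker, α k = χ k := hα
  let b : R → E := fun r => (((α (Function.surjInv hsurj r))⁻¹ : Circle) : ℂ) •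
    T (Function.surjInv hsurj r) v
  -- `T u v` is determined, up to the scalar `α u`, by the class of `u` modulo `ker sh`
  have key : ∀ u, T u v = (α u : ℂ) • b (sh u) := fun u => by
    set r := Function.surjInv hsurj (sh u) with hr
    have hr' : sh r = sh u := Function.surjInv_eq hsurj _
    have hd : sh (u - r) = 0 := by rw [map_sub, hr', sub_self]
    have h1 := hT.mul r (u - r) v
    rw [hd, AddChar.map_zero_eq_one, Circle.coe_one, one_smul, add_sub_cancel,
      hχ ⟨u - r, hd⟩, ← hα, map_smul] at h1
    have h2 : α u = α r * α (u - r) := by rw [← AddChar.map_add_eq_mul, add_sub_cancel]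
    simp only [b, ← hr, smul_smul, ← Circle.coe_mul]
    rw [← h1, h2, mul_comm (α r), mul_inv_cancel_right]
  have hform : ∀ u r, T u (b r) = ((α u * ψ u r : Circle) : ℂ) • b (r + sh u) := fun u r => by
    set w := Function.surjInv hsurj r with hw
    have hwr : sh w = r := Function.surjInv_eq hsurj _
    have h1 : b r = (((α w)⁻¹ : Circle) : ℂ) • T w v := rfl
    rw [h1, map_smul, hT.mul, key, map_add sh, hwr, smul_smul, smul_smul, ← Circle.coe_mul,
      ← Circle.coe_mul, add_comm (sh u), AddChar.map_add_eq_mul]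
    rw [mul_comm (α u) (α w), mul_assoc, mul_left_comm (ψ u r), inv_mul_cancel_left,
      mul_comm (ψ u r)]
  refine ⟨α, b, ⟨fun r => ?_, fun r r' hrr => ?_⟩, fun r => W.smul_mem _ (hinv _ _ hv), hform⟩
  · simp only [b, norm_smul, hnorm, hv1, Circle.norm_coe, mul_one]
  · obtain ⟨u, hu, hne⟩ : ∃ u, sh u = 0 ∧ ψ u r ≠ ψ u r' := by
      by_contra! h
      exact hrr (hsep _ _ h)
    have h := hT.isometry u (b r) (b r')
    rw [hform, hform, hu, add_zero, add_zero, inner_circle_smul] at h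
    by_contra h0
    have h1 := mul_right_cancel₀ h0 (h.trans (one_mul _).symm)
    have h2 : (α u * ψ u r)⁻¹ * (α u * ψ u r') = 1 := Circle.ext h1
    exact hne (mul_left_cancel (inv_mul_eq_one.1 h2))

/-- A projective representation contains an orthogonal sum of `l` standard irreducible ones as
long as their total dimension does not exceed that of the space. -/
theorem IsProjRep.exists_family [Fintype R] [DecidableEq R] {T : L → E →ₗ[ℂ] E}
    (hT : IsProjRep sh ψ T)
    (hsurj : Function.Surjective sh)
    (hsep : ∀ r r', (∀ u, sh u = 0 → ψ u r = ψ u r') → r = r') (l : ℕ)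
    (hl : ∀ k < l, k * Fintype.card R < Module.finrank ℂ E) :
    ∃ (α : Fin l → AddChar L Circle) (b : Fin l × R → E), Orthonormal ℂ b ∧
      ∀ u q, T u (b q) = ((α q.1 u * ψ u q.2 : Circle) : ℂ) • b (q.1, q.2 + sh u) := by
  induction l with
  | zero => exact ⟨Fin.elim0, fun q => q.1.elim0, ⟨fun q => q.1.elim0, fun q => q.1.elim0⟩,
      fun u q => q.1.elim0⟩
  | succ l ih =>
    obtain ⟨α, b, hb, hform⟩ := ih fun k hk => hl k (hk.trans l.lt_succ_self)
    set W : Submodule ℂ E := (Submodule.span ℂ (Set.range b))ᗮ with hWdef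
    have memW : ∀ x, x ∈ W ↔ ∀ q, inner ℂ (b q) x = 0 := fun x => by
      rw [hWdef, Submodule.mem_orthogonal]
      refine ⟨fun h q => h _ (Submodule.subset_span ⟨q, rfl⟩), fun h y hy => ?_⟩
      induction hy using Submodule.span_induction with
      | mem y hy => obtain ⟨q, rfl⟩ := hy; exact h q
      | zero => simp
      | add y z _ _ h1 h2 => rw [inner_add_left, h1, h2, add_zero]
      | smul c y _ h1 => rw [inner_smul_left, h1, mul_zero]
    have hW : W ≠ ⊥ := by
      intro h
      rw [hWdef, Submodule.orthogonal_eq_bot_iff] at h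
      have h1 := finrank_span_eq_card hb.linearIndependent
      rw [h, finrank_top, Fintype.card_prod, Fintype.card_fin] at h1
      exact absurd (hl l l.lt_succ_self) (by omega)
    have hinv : ∀ u, ∀ x ∈ W, T u x ∈ W := fun u x hx => by
      rw [memW] at hx ⊢
      intro q
      have h1 := hform u (q.1, q.2 - sh u)
      simp only [sub_add_cancel] at h1
      have h2 := hT.isometry u (b (q.1, q.2 - sh u)) x
      rw [hx, h1, inner_smul_left] at h2
      exact (mul_eq_zero.1 h2).resolve_left (by simp)
    obtain ⟨β, b', hb', hmem, hform'⟩ := hT.exists_irreducible hsurj hsep W hW hinv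
    have horth : ∀ q r, inner ℂ (b q) (b' r) = 0 := fun q r => (memW _).1 (hmem r) q
    rw [orthonormal_iff_ite] at hb hb'
    refine ⟨Fin.cons β α, fun q => (Fin.cons b' (fun a r => b (a, r)) : Fin (l + 1) → R → E) q.1 q.2,
      ?_, ?_⟩
    · rw [orthonormal_iff_ite]
      rintro ⟨a, r⟩ ⟨a', r'⟩
      refine Fin.cases ?_ (fun a => ?_) a <;> refine Fin.cases ?_ (fun a' => ?_) a'
      · simp [hb']
      · simp only [Fin.cons_zero, Fin.cons_succ, Prod.mk.injEq, (Fin.succ_ne_zero a').symm,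
          false_and, if_false]
        rw [← inner_conj_symm, horth, map_zero]
      · simp only [Fin.cons_zero, Fin.cons_succ, Prod.mk.injEq, (Fin.succ_ne_zero a),
          false_and, if_false, horth]
      · simp [hb]
    · rintro u ⟨a, r⟩
      refine Fin.cases ?_ (fun a => ?_) a
      · simp [hform']
      · simp [hform]

/-- Otherwise, one standard irreducible representation more than fits into `E` could be split
off. -/
theorem IsProjRep.card_dvd_finrank [Fintype R] {T : L → E →ₗ[ℂ] E} (hT : IsProjRep sh ψ T)
    (hsurj : Function.Surjective sh)
    (hsep : ∀ r r', (∀ u, sh u = 0 → ψ u r = ψ u r') → r = r') :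
    Fintype.card R ∣ Module.finrank ℂ E := by
  classical
  by_contra hnd
  set N := Fintype.card R
  set m := Module.finrank ℂ E
  have hm : m / N * N < m := lt_of_le_of_ne (Nat.div_mul_le_self m N) fun h =>
    hnd (Dvd.intro_left _ h)
  obtain ⟨α, b, hb, -⟩ := hT.exists_family hsurj hsep (m / N + 1) fun k hk =>
    lt_of_le_of_lt (Nat.mul_le_mul_right N (Nat.lt_succ_iff.1 hk)) hm
  have h1 := hb.linearIndependent.fintype_card_le_finrank
  rw [Fintype.card_prod, Fintype.card_fin] at h1
  have h2 : m < (m / N + 1) * N := by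
    have : 0 < N := Fintype.card_pos
    rw [mul_comm]; exact Nat.lt_mul_div_succ m this
  exact absurd h1 (not_le.2 h2)

end Heisenberg


/-! ### Monomial matrices and the standard representations -/

section Monomial

variable {ι : Type*} [Fintype ι] [DecidableEq ι]

/-- The unitary matrix sending the basis vector `e_q` to `d q • e_{σ q}`. -/
def monoU (σ : Equiv.Perm ι) (d : ι → Circle) : Matrix.unitaryGroup ι ℂ :=
  ⟨Matrix.of fun p q => if p = σ q then (d q : ℂ) else 0, by
    rw [Matrix.mem_unitaryGroup_iff']
    ext p q
    simp only [Matrix.mul_apply, Matrix.star_apply, Matrix.of_apply, apply_ite star, star_zero,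
      ite_mul, zero_mul, mul_ite, mul_zero, Finset.sum_ite_eq', Finset.mem_univ, if_true,
      Matrix.one_apply, σ.injective.eq_iff]
    by_cases h : p = q
    · subst h
      simp [← Circle.coe_inv_eq_conj]
    · simp [h, Ne.symm h]⟩

theorem monoU_apply (σ : Equiv.Perm ι) (d : ι → Circle) (p q : ι) :
    (monoU σ d : Matrix ι ι ℂ) p q = if p = σ q then (d q : ℂ) else 0 := rfl

theorem mul_monoU_apply (M : Matrix ι ι ℂ) (σ : Equiv.Perm ι) (d : ι → Circle) (p q : ι) :
    (M * (monoU σ d : Matrix ι ι ℂ)) p q = d q * M p (σ q) := by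
  simp [Matrix.mul_apply, monoU_apply, mul_comm]

theorem monoU_mul (σ τ : Equiv.Perm ι) (d d' : ι → Circle) :
    monoU σ d * monoU τ d' = monoU (σ * τ) fun q => d (τ q) * d' q := by
  refine Subtype.ext (Matrix.ext fun p q => ?_)
  rw [Submonoid.coe_mul, mul_monoU_apply, monoU_apply, monoU_apply, mul_ite, mul_zero,
    Circle.coe_mul, mul_comm]
  rfl

theorem monoU_one (d : ι → Circle) :
    (monoU 1 d : Matrix ι ι ℂ) = Matrix.diagonal fun i => (d i : ℂ) :=
  Matrix.ext fun p q => by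
    rw [monoU_apply, Matrix.diagonal_apply]
    split_ifs with h1 h2 h2
    · rw [h2]
    · exact absurd h1 h2
    · exact absurd h2 h1
    · rfl

theorem monoU_one_one : monoU (1 : Equiv.Perm ι) 1 = 1 :=
  Subtype.ext (by simp [monoU_one])

/-- The permutation comes from a nonvanishing term of the Leibniz expansion of `det g`. -/
theorem exists_perm_of_conj_diagonal {κ : Type*} (g : Matrix.unitaryGroup ι ℂ)
    (d d' : κ → ι → Circle) (h : ∀ u, g * monoU 1 (d u) = monoU 1 (d' u) * g) :
    ∃ σ : Equiv.Perm ι, ∀ u i, d u i = d' u (σ i) := by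
  have hdet : (g : Matrix ι ι ℂ).det ≠ 0 := by
    have h1 : (g : Matrix ι ι ℂ) * star (g : Matrix ι ι ℂ) = 1 := Matrix.mem_unitaryGroup_iff.1 g.2
    intro h0
    have := congrArg Matrix.det h1
    rw [Matrix.det_mul, h0, zero_mul, Matrix.det_one] at this
    exact zero_ne_one this
  rw [Matrix.det_apply] at hdet
  obtain ⟨σ, -, hσ⟩ := Finset.exists_ne_zero_of_sum_ne_zero hdet
  refine ⟨σ, fun u i => ?_⟩
  have hne : (g : Matrix ι ι ℂ) (σ i) i ≠ 0 := fun h0 => hσ (by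
    have h2 := Finset.prod_eq_zero (f := fun j => (g : Matrix ι ι ℂ) (σ j) j) (Finset.mem_univ i) h0
    simp only [h2, smul_zero])
  have h1 := congrFun (congrFun (congrArg Subtype.val (h u)) (σ i)) i
  rw [Submonoid.coe_mul, Submonoid.coe_mul, mul_monoU_apply, monoU_one, Matrix.diagonal_mul] at h1
  exact Circle.ext (mul_right_cancel₀ hne h1)

variable {L R : Type*} [AddCommGroup L] [AddCommGroup R]
  (sh : L →+ R) (ψ : AddChar L (AddChar R Circle)) {l m : ℕ} (eq : Fin l × R ≃ Fin m)

/-- The permutation `(a, r) ↦ (a, r + s)` of `Fin l × R`, transported to `Fin m`. -/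
def shiftPerm (s : R) : Equiv.Perm (Fin m) :=
  (eq.symm.trans ((Equiv.refl (Fin l)).prodCongr (Equiv.addRight s))).trans eq

theorem shiftPerm_apply (s : R) (q : Fin l × R) : shiftPerm eq s (eq q) = eq (q.1, q.2 + s) := by
  simp [shiftPerm, Prod.map]

/-- The standard projective representation of `L` on `ℂᵐ ≅ (ℂ[R])ˡ`, twisted on the `a`-th
summand by the character `α a`: it sends `e_{(a, r)}` to
`α a u * ψ u r • e_{(a, r + sh u)}`. -/
def stdU (α : Fin l → AddChar L Circle) (u : L) : U m :=
  monoU (shiftPerm eq (sh u)) fun p => α (eq.symm p).1 u * ψ u (eq.symm p).2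

theorem perm_ext_equiv {α β : Type*} (e : α ≃ β) {σ τ : Equiv.Perm β}
    (h : ∀ q, σ (e q) = τ (e q)) : σ = τ :=
  Equiv.ext fun p => by rw [← e.apply_symm_apply p, h]

theorem funext_equiv {α β γ : Type*} (e : α ≃ β) {f g : β → γ}
    (h : ∀ q, f (e q) = g (e q)) : f = g :=
  funext fun p => by rw [← e.apply_symm_apply p, h]

/-- Multiplying a unitary matrix by a scalar of modulus one. -/
def scalarU (z : Circle) : Matrix.unitaryGroup ι ℂ := monoU 1 fun _ => z

theorem coe_scalarU (z : Circle) : ((scalarU z : Matrix.unitaryGroup ι ℂ) : Matrix ι ι ℂ) =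
    (z : ℂ) • (1 : Matrix ι ι ℂ) := by
  rw [scalarU, monoU_one, Matrix.smul_one_eq_diagonal]

theorem coe_scalarU_mul (z : Circle) (g : Matrix.unitaryGroup ι ℂ) :
    ((scalarU z * g : Matrix.unitaryGroup ι ℂ) : Matrix ι ι ℂ) = (z : ℂ) • (g : Matrix ι ι ℂ) := by
  rw [Submonoid.coe_mul, coe_scalarU, smul_mul_assoc, one_mul]

theorem scalarU_comm (z : Circle) (g : Matrix.unitaryGroup ι ℂ) :
    scalarU z * g = g * scalarU z :=
  Subtype.ext (by rw [Submonoid.coe_mul, Submonoid.coe_mul, coe_scalarU]; simp)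

theorem scalarU_mul (z w : Circle) :
    (scalarU (z * w) : Matrix.unitaryGroup ι ℂ) = scalarU z * scalarU w := by
  rw [scalarU, scalarU, scalarU, monoU_mul, mul_one]

theorem scalarU_one : (scalarU 1 : Matrix.unitaryGroup ι ℂ) = 1 := monoU_one_one

/-- `scalarU` as a homomorphism. -/
def scalarHom (ι : Type*) [Fintype ι] [DecidableEq ι] : Circle →* Matrix.unitaryGroup ι ℂ where
  toFun := scalarU
  map_one' := scalarU_one
  map_mul' := scalarU_mul

theorem scalarU_zpow (z : Circle) (k : ℤ) :
    (scalarU (z ^ k) : Matrix.unitaryGroup ι ℂ) = scalarU z ^ k := map_zpow (scalarHom ι) z k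

theorem scalarU_mul_monoU (z : Circle) (σ : Equiv.Perm ι) (d : ι → Circle) :
    scalarU z * monoU σ d = monoU σ fun q => z * d q := by
  rw [scalarU, monoU_mul, one_mul]

theorem stdU_mul (α : Fin l → AddChar L Circle) (u v : L) :
    stdU sh ψ eq α u * stdU sh ψ eq α v = scalarU (ψ u (sh v)) * stdU sh ψ eq α (u + v) := by
  rw [stdU, stdU, stdU, monoU_mul, scalarU_mul_monoU]
  congr 1
  · refine perm_ext_equiv eq fun q => ?_
    rw [Equiv.Perm.mul_apply, shiftPerm_apply, shiftPerm_apply, shiftPerm_apply, map_add, add_assoc,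
      add_comm (sh v)]
  · refine funext_equiv eq fun q => ?_
    simp only [shiftPerm_apply, Equiv.symm_apply_apply, AddChar.map_add_eq_mul, AddChar.mul_apply]
    rw [mul_mul_mul_comm, mul_comm (ψ u q.2), mul_assoc (ψ u (sh v)), mul_left_comm]

/-- The intertwiner permutes the summands by `τ`, translates the `a`-th one by `s a`, and
multiplies it by the character `χ a` of `R`. -/
theorem stdU_conj {α α' : Fin l → AddChar L Circle} (τ : Equiv.Perm (Fin l)) (s : Fin l → R)
    (χ : Fin l → AddChar R Circle)
    (h : ∀ a u, α' a u * χ a (sh u) = α (τ a) u * ψ u (s a)) :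
    ∃ g : U m, ∀ u, stdU sh ψ eq α u = g * stdU sh ψ eq α' u * g⁻¹ := by
  let ρ' : Fin l × R ≃ Fin l × R :=
    { toFun := fun q => (τ q.1, q.2 + s q.1)
      invFun := fun q => (τ.symm q.1, q.2 - s (τ.symm q.1))
      left_inv := fun q => by simp
      right_inv := fun q => by simp }
  let ρ : Equiv.Perm (Fin m) := (eq.symm.trans ρ').trans eq
  have hρ : ∀ q, ρ (eq q) = eq (τ q.1, q.2 + s q.1) := fun q => by simp [ρ, ρ']
  refine ⟨monoU ρ fun p => χ (eq.symm p).1 (eq.symm p).2, fun u => ?_⟩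
  rw [eq_mul_inv_iff_mul_eq, stdU, stdU, monoU_mul, monoU_mul]
  congr 1
  · refine perm_ext_equiv eq fun q => ?_
    rw [Equiv.Perm.mul_apply, Equiv.Perm.mul_apply, hρ, shiftPerm_apply, shiftPerm_apply, hρ]
    simp only [add_right_comm]
  · refine funext_equiv eq fun q => ?_
    simp only [hρ, shiftPerm_apply, Equiv.symm_apply_apply, AddChar.map_add_eq_mul]
    have h1 : χ q.1 q.2 * χ q.1 (sh u) * (α' q.1 u * ψ u q.2) =
      χ q.1 q.2 * ψ u q.2 * (α' q.1 u * χ q.1 (sh u)) := by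
      rw [mul_assoc, mul_assoc]; congr 1
      rw [mul_comm (α' q.1 u) (ψ u q.2), mul_left_comm, mul_comm (χ _ _)]
    rw [h1, h]
    rw [mul_comm (χ q.1 q.2), mul_comm (ψ u q.2) (ψ u (s q.1)), ← mul_assoc (α _ _),
      mul_assoc (_ * _), mul_comm (_ * _) (ψ u q.2 * _)]

/-- Every projective unitary representation on `ℂᵐ` is conjugate to a standard one. -/
theorem exists_conj_stdU [Fintype R] (F : L → U m) (h0 : F 0 = 1)
    (hF : ∀ u v, F u * F v = scalarU (ψ u (sh v)) * F (u + v)) (hsurj : Function.Surjective sh)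
    (hsep : ∀ r r', (∀ u, sh u = 0 → ψ u r = ψ u r') → r = r') :
    Fintype.card R ∣ m ∧ ∀ (l : ℕ) (eq : Fin l × R ≃ Fin m), ∃ (α : Fin l → AddChar L Circle)
      (g : U m), ∀ u, F u = g * stdU sh ψ eq α u * g⁻¹ := by
  classical
  let T : L → EuclideanSpace ℂ (Fin m) →ₗ[ℂ] EuclideanSpace ℂ (Fin m) := fun u =>
    Matrix.toEuclideanLin (F u : Matrix (Fin m) (Fin m) ℂ)
  have hT : IsProjRep sh ψ T :=
    { zero_apply := fun x => by simp [T, h0]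
      mul := fun u v x => by
        have := congrArg Subtype.val (hF u v)
        rw [coe_scalarU_mul, Submonoid.coe_mul] at this
        simp only [T]
        rw [← LinearMap.smul_apply, ← map_smul, ← this]
        simp [Matrix.toLpLin_apply, Matrix.mulVec_mulVec]
      isometry := fun u x y => by
        have : star (F u : Matrix (Fin m) (Fin m) ℂ) * (F u : Matrix (Fin m) (Fin m) ℂ) = 1 :=
          Matrix.mem_unitaryGroup_iff'.1 (F u).2
        simp only [T]
        rw [← LinearMap.adjoint_inner_right, ← Matrix.toEuclideanLin_conjTranspose_eq_adjoint,
          ← Matrix.star_eq_conjTranspose]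
        congr 1
        have h2 : (Matrix.toEuclideanLin (star (F u : Matrix (Fin m) (Fin m) ℂ) *
          (F u : Matrix (Fin m) (Fin m) ℂ))) y = y := by rw [this]; simp
        rw [← h2]
        simp [Matrix.toLpLin_apply, Matrix.mulVec_mulVec, this] }
  have hcard := hT.card_dvd_finrank hsurj hsep
  rw [finrank_euclideanSpace_fin] at hcard
  refine ⟨hcard, fun l eq => ?_⟩
  have hlm : l * Fintype.card R = m := by
    have := Fintype.card_congr eq
    simpa using this
  obtain ⟨α, b, hb, hform⟩ := hT.exists_family hsurj hsep l fun k hk => by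
    rw [finrank_euclideanSpace_fin, ← hlm]
    exact Nat.mul_lt_mul_of_pos_right hk Fintype.card_pos
  let g : U m := ⟨Matrix.of fun p q => b (eq.symm q) p, by
    rw [Matrix.mem_unitaryGroup_iff']
    ext p q
    have := orthonormal_iff_ite.1 hb (eq.symm p) (eq.symm q)
    simp only [eq.symm.injective.eq_iff] at this
    rw [Matrix.one_apply, ← this, Matrix.mul_apply, PiLp.inner_apply]
    simp [mul_comm]⟩
  refine ⟨α, g, fun u => ?_⟩
  rw [eq_mul_inv_iff_mul_eq]
  refine Subtype.ext (Matrix.ext fun p q' => ?_)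
  obtain ⟨q, rfl⟩ := eq.surjective q'
  rw [Submonoid.coe_mul, Submonoid.coe_mul, stdU, mul_monoU_apply, shiftPerm_apply,
    Equiv.symm_apply_apply]
  have h1 := congrArg (fun x => x p) (hform u q)
  simp only [T, Matrix.toLpLin_apply, PiLp.smul_apply, smul_eq_mul] at h1
  simpa [g, Matrix.mul_apply, Matrix.mulVec, dotProduct] using h1

theorem stdU_eq_diagonal {u : L} (hu : sh u = 0) (hψ : ψ u = 1) (α : Fin l → AddChar L Circle) :
    stdU sh ψ eq α u = monoU 1 fun p => α (eq.symm p).1 u := by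
  rw [stdU, hu, hψ]
  congr 1
  · exact perm_ext_equiv eq fun q => by simp [shiftPerm_apply]
  · funext p
    simp

/-- A unitary matrix is unitarily diagonalizable; this is `exists_conj_stdU` for `L = ℤ` and
trivial `R`. -/
theorem exists_conj_diagonal (X : U m) :
    ∃ (g : U m) (d : Fin m → Circle), X = g * monoU 1 d * g⁻¹ := by
  obtain ⟨-, h⟩ := exists_conj_stdU (m := m) (0 : ℤ →+ Unit) 1 (fun u => X ^ u) (zpow_zero X)
    (fun u v => by
      rw [AddChar.one_apply, AddChar.one_apply, scalarU_one, one_mul, zpow_add])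
    (fun _ => ⟨0, rfl⟩) (fun _ _ _ => rfl)
  obtain ⟨α, g, hg⟩ := h m (Equiv.prodPUnit (Fin m))
  exact ⟨g, _, by
    rw [← stdU_eq_diagonal (u := 1) (0 : ℤ →+ Unit) 1 _ rfl (AddChar.one_apply _) α, ← hg, zpow_one]⟩

end Monomial


/-! ### A normal form for the extension and for its homomorphisms -/

section NormalForm

variable {n t : ℕ}

/-- The bilinear form `(u, v) ↦ ∑ₖ cₖ uₖ v_{t+k}` on `ℤⁿ`. -/
def wform (ht : 2 * t ≤ n) (c : Fin t → ℕ) (u v : Fin n → ℤ) : ℤ :=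
  ∑ k : Fin t, (c k : ℤ) * (u ⟨k, by omega⟩ * v ⟨t + k, by omega⟩)

section wform
variable (ht : 2 * t ≤ n) (c : Fin t → ℕ) (u u' v v' : Fin n → ℤ)

theorem wform_add_left : wform ht c (u + u') v = wform ht c u v + wform ht c u' v := by
  simp only [wform, ← Finset.sum_add_distrib, Pi.add_apply]
  exact Finset.sum_congr rfl fun _ _ => by ring

theorem wform_add_right : wform ht c u (v + v') = wform ht c u v + wform ht c u v' := by
  simp only [wform, ← Finset.sum_add_distrib, Pi.add_apply]
  exact Finset.sum_congr rfl fun _ _ => by ring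

theorem wform_zero_left : wform ht c 0 v = 0 := by simp [wform]

theorem wform_zero_right : wform ht c u 0 = 0 := by simp [wform]

theorem wform_neg_left : wform ht c (-u) v = -wform ht c u v := by
  rw [eq_neg_iff_add_eq_zero, ← wform_add_left, neg_add_cancel, wform_zero_left]

theorem wform_neg_right : wform ht c u (-v) = -wform ht c u v := by
  rw [eq_neg_iff_add_eq_zero, ← wform_add_right, neg_add_cancel, wform_zero_right]

theorem wform_single_of_ne {i j : Fin n} (h : ∀ k : Fin t, ¬ (i.val = k ∧ j.val = t + k)) :
    wform ht c (Pi.single i 1) (Pi.single j 1) = 0 := by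
  refine Finset.sum_eq_zero fun k _ => ?_
  by_cases h1 : i.val = k
  · have h2 : (⟨t + k, by omega⟩ : Fin n) ≠ j := fun h2 => h k ⟨h1, by rw [← h2]⟩
    rw [Pi.single_eq_of_ne h2]; simp
  · have h2 : (⟨k, by omega⟩ : Fin n) ≠ i := fun h2 => h1 (by rw [← h2])
    rw [Pi.single_eq_of_ne h2]; simp

theorem wform_single_single (k : Fin t) :
    wform ht c (Pi.single ⟨k, by omega⟩ 1) (Pi.single ⟨t + k, by omega⟩ 1) = c k := by
  rw [wform, Finset.sum_eq_single k]
  · simp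
  · intro k' _ hk
    have h2 : (⟨k', by omega⟩ : Fin n) ≠ ⟨k, by omega⟩ := fun h2 =>
      hk (Fin.ext (Fin.mk.inj h2))
    rw [Pi.single_eq_of_ne h2]; simp
  · simp

end wform

/-- The lattice `ℤⁿ` is generated by the standard basis vectors. -/
theorem pi_int_induction {p : (Fin n → ℤ) → Prop} (h0 : p 0) (hadd : ∀ u v, p u → p v → p (u + v))
    (hneg : ∀ u, p u → p (-u)) (hs : ∀ i, p (Pi.single i 1)) (u : Fin n → ℤ) : p u := by
  let K : AddSubgroup (Fin n → ℤ) :=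
    { carrier := {u | p u}
      zero_mem' := h0
      add_mem' := fun {a b} => hadd a b
      neg_mem' := fun {a} => hneg a }
  have hu : u = ∑ i, u i • (Pi.single i 1 : Fin n → ℤ) := by
    rw [← Finset.univ_sum_single u]
    refine Finset.sum_congr rfl fun i _ => ?_
    rw [← Pi.single_smul]
    simp
  have : u ∈ K := by
    rw [hu]
    exact K.sum_mem fun i _ => K.zsmul_mem (hs i) _
  exact this

/-- Elements of `Γ` have the unique normal form `x ^ z * s u` with `z : ℤ` and `u : ℤⁿ`, where
`x` is central and `s` multiplies with the factor set `wform`. -/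
structure IsNormalForm {Γ : Type*} [Group Γ] (x : Γ) (ht : 2 * t ≤ n) (c : Fin t → ℕ)
    (s : (Fin n → ℤ) → Γ) : Prop where
  central : ∀ γ, γ * x = x * γ
  mul : ∀ u v, s u * s v = x ^ wform ht c u v * s (u + v)
  exists_eq : ∀ γ, ∃ (z : ℤ) (u : Fin n → ℤ), γ = x ^ z * s u
  unique : ∀ (z z' : ℤ) (u u' : Fin n → ℤ), x ^ z * s u = x ^ z' * s u' → z = z' ∧ u = u'

/-- The factor sets of `Γ` and the cocycle `wedgeCochain` differ by a coboundary, which is absorbed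
into the choice of the section; the coordinates on `ℤⁿ` are those of the basis `e`. -/
theorem exists_isNormalForm (ht : 2 * t ≤ n) (c : Fin t → ℕ)
    (e : Module.Basis (Fin n) ℤ (Fin n → ℤ)) {Γ : Type*} [Group Γ]
    (S : GroupExtension (Multiplicative ℤ) Γ (Multiplicative (Fin n → ℤ)))
    (hS : IsCentral S) (hω : kInvariant S hS = wedgeClass e ht c) :
    ∃ s, IsNormalForm (S.inl (Multiplicative.ofAdd 1)) ht c s := by
  have hc : ∀ (z : Multiplicative ℤ) (y : Γ), y * S.inl z = S.inl z * y := fun z y =>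
    Subgroup.mem_center_iff.1 (hS ⟨z, rfl⟩) y
  obtain ⟨σ⟩ : Nonempty S.Section := ⟨⟨Function.surjInv S.rightHom_surjective,
    Function.rightInverse_surjInv S.rightHom_surjective⟩⟩
  rw [kInvariant_eq S hS σ, factorSetClass, wedgeClass, groupCohomology.H2π_eq_iff] at hω
  obtain ⟨b, hb⟩ := hω
  replace hb : ∀ g h, b h - b (g * h) + b g =
      factorSet S σ (g, h) - wedgeCochain e ht c (g, h) := fun g h => congrFun hb (g, h)
  set x := S.inl (Multiplicative.ofAdd 1) with hx
  have hxz : ∀ z : ℤ, S.inl (Multiplicative.ofAdd z) = x ^ z := fun z => by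
    rw [hx, ← map_zpow, ← ofAdd_zsmul]; simp
  have hxr : S.rightHom x = 1 := by simp [hx]
  let s : (Fin n → ℤ) → Γ := fun u =>
    x ^ (-b (Multiplicative.ofAdd (e.equivFun.symm u)) : ℤ) *
      σ (Multiplicative.ofAdd (e.equivFun.symm u))
  have hxc : ∀ (z : ℤ) γ, γ * x ^ z = x ^ z * γ := fun z γ => by rw [← hxz, hc]
  have hsr : ∀ (z : ℤ) u, S.rightHom (x ^ z * s u) = Multiplicative.ofAdd (e.equivFun.symm u) :=
    fun z u => by simp [s, hxr]
  refine ⟨s, ⟨fun γ => hc _ γ, fun u v => ?_, fun γ => ?_, fun z z' u u' h => ?_⟩⟩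
  · set U := Multiplicative.ofAdd (e.equivFun.symm u) with hU
    set V := Multiplicative.ofAdd (e.equivFun.symm v) with hV
    have hUV : Multiplicative.ofAdd (e.equivFun.symm (u + v)) = U * V := by
      rw [map_add, ofAdd_add]
    have hw : wedgeCochain e ht c (U, V) = wform ht c u v := by
      simp only [wedgeCochain, wform, hU, hV, toAdd_ofAdd]
      refine Finset.sum_congr rfl fun k _ => ?_
      simp only [Module.Basis.coord_apply, ← Module.Basis.equivFun_apply,
        LinearEquiv.apply_symm_apply]
    have h1 := factorSet_spec S σ U V
    rw [hxz] at h1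
    simp only [s, hUV, ← hU, ← hV]
    rw [mul_assoc, ← mul_assoc (σ U), hxc, mul_assoc, h1, ← mul_assoc, ← mul_assoc, ← mul_assoc,
      ← zpow_add, ← zpow_add, ← zpow_add]
    congr 2
    have := hb U V
    rw [hw] at this
    linarith
  · set u := e.equivFun (Multiplicative.toAdd (S.rightHom γ)) with hu
    have : γ * (s u)⁻¹ ∈ S.inl.range := by
      rw [S.range_inl_eq_ker_rightHom, MonoidHom.mem_ker, map_mul, map_inv]
      have := hsr 0 u
      rw [zpow_zero, one_mul] at this
      rw [this, hu, LinearEquiv.symm_apply_apply, ofAdd_toAdd, mul_inv_cancel]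
    obtain ⟨z, hz⟩ := this
    refine ⟨Multiplicative.toAdd z, u, ?_⟩
    rw [← hxz, ofAdd_toAdd, hz, inv_mul_cancel_right]
  · have h1 := congrArg S.rightHom h
    rw [hsr, hsr] at h1
    have h2 : u = u' := e.equivFun.symm.injective (Multiplicative.ofAdd.injective h1)
    subst h2
    refine ⟨?_, rfl⟩
    have h3 := mul_right_cancel h
    rw [← hxz, ← hxz] at h3
    exact Multiplicative.ofAdd.injective (S.inl_injective h3)

variable {ht : 2 * t ≤ n} {c : Fin t → ℕ} {Γ : Type*} [Group Γ] {x : Γ} {s : (Fin n → ℤ) → Γ}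

theorem IsNormalForm.map_zero (hs : IsNormalForm x ht c s) : s 0 = 1 := by
  have := hs.mul 0 0
  rw [wform_zero_left, zpow_zero, one_mul, add_zero] at this
  exact mul_eq_left.1 this

theorem IsNormalForm.mul_zpow_comm (hs : IsNormalForm x ht c s) (γ : Γ) (z : ℤ) :
    γ * x ^ z = x ^ z * γ := (Commute.zpow_right (hs.central γ) z)

/-- Homomorphisms out of `Γ` are given by maps on `ℤⁿ` that are multiplicative up to `wform`. -/
theorem IsNormalForm.exists_hom (hs : IsNormalForm x ht c s) {H : Type*} [Group H] (y : H)
    (F : (Fin n → ℤ) → H) (hy : ∀ h, h * y = y * h)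
    (hF : ∀ u v, F u * F v = y ^ wform ht c u v * F (u + v)) :
    ∃ f : Γ →* H, f x = y ∧ ∀ u, f (s u) = F u := by
  choose z u hzu using hs.exists_eq
  have hyz : ∀ h (k : ℤ), h * y ^ k = y ^ k * h := fun h k => Commute.zpow_right (hy h) k
  have hF0 : F 0 = 1 := by
    have := hF 0 0
    rw [wform_zero_left, zpow_zero, one_mul, add_zero] at this
    exact mul_eq_left.1 this
  have key : ∀ (k : ℤ) v, y ^ z (x ^ k * s v) * F (u (x ^ k * s v)) = y ^ k * F v := fun k v => by
    obtain ⟨h1, h2⟩ := hs.unique _ _ _ _ (hzu (x ^ k * s v))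
    rw [← h1, ← h2]
  let f : Γ →* H :=
    { toFun := fun γ => y ^ z γ * F (u γ)
      map_one' := by
        have := key 0 0
        rw [hs.map_zero, zpow_zero, zpow_zero, one_mul, hF0, one_mul] at this
        exact this
      map_mul' := fun γ δ => by
        have h1 : γ * δ = x ^ (z γ + z δ + wform ht c (u γ) (u δ)) * s (u γ + u δ) := by
          conv_lhs => rw [hzu γ, hzu δ]
          rw [mul_assoc, ← mul_assoc (s (u γ)), hs.mul_zpow_comm, mul_assoc, hs.mul, ← mul_assoc,
            ← mul_assoc, ← zpow_add, ← zpow_add]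
        rw [h1, key, mul_assoc, ← mul_assoc (F (u γ)), hyz, mul_assoc, hF, ← mul_assoc,
            ← mul_assoc, ← zpow_add, ← zpow_add] }
  refine ⟨f, ?_, fun v => ?_⟩
  · have := key 1 0
    rw [hs.map_zero, mul_one, zpow_one, hF0, mul_one, zpow_one] at this
    exact this
  · have := key 0 v
    rw [zpow_zero, one_mul, zpow_zero, one_mul] at this
    exact this

theorem IsNormalForm.map_mul_map (hs : IsNormalForm x ht c s) {H : Type*} [Group H] (f : Γ →* H)
    (u v : Fin n → ℤ) : f (s u) * f (s v) = f x ^ wform ht c u v * f (s (u + v)) := by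
  rw [← map_mul, hs.mul, map_mul, map_zpow]

theorem IsNormalForm.hom_ext' (hs : IsNormalForm x ht c s) {H : Type*} [Group H] {f g : Γ →* H}
    (hx : f x = g x) (h : ∀ u, f (s u) = g (s u)) : f = g :=
  MonoidHom.ext fun γ => by
    obtain ⟨z, u, rfl⟩ := hs.exists_eq γ
    rw [map_mul, map_mul, map_zpow, map_zpow, hx, h]

theorem IsNormalForm.hom_ext (hs : IsNormalForm x ht c s) {H : Type*} [Group H] {f g : Γ →* H}
    (hx : f x = g x) (h : ∀ i, f (s (Pi.single i 1)) = g (s (Pi.single i 1))) : f = g := by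
  have hadd : ∀ u v, f (s u) = g (s u) → f (s v) = g (s v) → f (s (u + v)) = g (s (u + v)) :=
    fun u v hu hv => by
      have h1 := hs.map_mul_map f u v
      rw [hu, hv, hs.map_mul_map, hx] at h1
      exact (mul_left_cancel h1).symm
  refine hs.hom_ext' hx fun u => ?_
  refine pi_int_induction (p := fun u => f (s u) = g (s u)) (by simp [hs.map_zero]) hadd
    (fun u hu => ?_) h u
  have h1 := hs.map_mul_map f u (-u)
  have h2 := hs.map_mul_map g u (-u)
  rw [add_neg_cancel, hs.map_zero, map_one] at h1 h2
  rw [hx, ← h2, hu] at h1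
  exact mul_left_cancel h1

theorem IsNormalForm.map_single_comm (hs : IsNormalForm x ht c s) {H : Type*} [Group H]
    (f : Γ →* H) (u v : Fin n → ℤ) : f (s u) * f (s v) =
      f x ^ (wform ht c u v - wform ht c v u) * (f (s v) * f (s u)) := by
  rw [hs.map_mul_map, hs.map_mul_map, ← mul_assoc, ← zpow_add, sub_add_cancel, add_comm u v]

/-- Elements `A i` whose commutators are the powers of a central element prescribed by `wform`
extend to `ℤⁿ`; the extension is a product in which the factors `A i` with `t ≤ i < 2 t` precede
the others. -/
theorem exists_extension_of_comm (ht : 2 * t ≤ n) (c : Fin t → ℕ) {H : Type*} [Group H] (y : H)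
    (hy : ∀ h, h * y = y * h) (A : Fin n → H)
    (hA : ∀ i j, A i * A j = y ^ (wform ht c (Pi.single i 1) (Pi.single j 1) -
      wform ht c (Pi.single j 1) (Pi.single i 1)) * (A j * A i)) :
    ∃ F : (Fin n → ℤ) → H, (∀ u v, F u * F v = y ^ wform ht c u v * F (u + v)) ∧
      ∀ i, F (Pi.single i 1) = A i := by
  classical
  have hyz : ∀ h (k : ℤ), h * y ^ k = y ^ k * h := fun h k => Commute.zpow_right (hy h) k
  -- `wform` vanishes on the span of the `e_{t+k}`, and on that of the other basis vectors, so
  -- that the corresponding `A i` commute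
  let Q : Fin n → Prop := fun i => t ≤ i.val ∧ i.val < 2 * t
  let B : Fin n → H := fun i => if Q i then A i else 1
  let C : Fin n → H := fun i => if Q i then 1 else A i
  have hw0 : ∀ i j, (Q i ∨ ¬ Q j) → wform ht c (Pi.single i 1) (Pi.single j 1) = 0 :=
    fun i j hij => wform_single_of_ne ht c fun k hk => by
      have := k.2
      simp only [Q] at hij
      omega
  have hAB : ∀ i j, (Q i ↔ Q j) → A i * A j = A j * A i := fun i j hij => by
    rw [hA, hw0 i j (by tauto), hw0 j i (by tauto), sub_self, zpow_zero, one_mul]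
  have hBB : ∀ i j, Commute (B i) (B j) := fun i j => by
    by_cases hi : Q i <;> by_cases hj : Q j <;> simp only [B, hi, hj, if_true, if_false,
      Commute.one_left, Commute.one_right]
    exact hAB i j (by tauto)
  have hCC : ∀ i j, Commute (C i) (C j) := fun i j => by
    by_cases hi : Q i <;> by_cases hj : Q j <;> simp only [C, hi, hj, if_true, if_false,
      Commute.one_left, Commute.one_right]
    exact hAB i j (by tauto)
  have hCB : ∀ i j, C i * B j = y ^ wform ht c (Pi.single i 1) (Pi.single j 1) * (B j * C i) :=
    fun i j => by
      by_cases hi : Q i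
      · simp [C, hi, hw0 i j (Or.inl hi)]
      · by_cases hj : Q j
        · simp only [C, B, hi, hj, if_true, if_false]
          rw [hA, hw0 j i (Or.inl hj), sub_zero]
        · simp [B, hj, hw0 i j (Or.inr hj)]
  have key : ∀ B : Fin n → H, (∀ i j, Commute (B i) (B j)) → ∃ P : (Fin n → ℤ) → H,
      P 0 = 1 ∧ (∀ u v, P (u + v) = P u * P v) ∧ ∀ i, P (Pi.single i 1) = B i := fun B hB => by
    have hB' : Pairwise fun i j => ∀ (a b : Multiplicative ℤ),
        Commute (zpowersHom H (B i) a) (zpowersHom H (B j) b) := fun i j _ a b =>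
      ((hB i j).zpow_left _).zpow_right _
    let P := MonoidHom.noncommPiCoprod (fun i => zpowersHom H (B i)) hB'
    refine ⟨fun u => P fun i => Multiplicative.ofAdd (u i), map_one P, fun u v => map_mul P _ _,
      fun i => ?_⟩
    have h1 : (fun j => Multiplicative.ofAdd ((Pi.single i 1 : Fin n → ℤ) j)) =
        Pi.mulSingle i (Multiplicative.ofAdd 1) := by
      funext j
      by_cases h : j = i
      · subst h; simp
      · simp [h]
    change P (fun j => Multiplicative.ofAdd ((Pi.single i 1 : Fin n → ℤ) j)) = B i
    rw [h1, MonoidHom.noncommPiCoprod_mulSingle]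
    simp
  obtain ⟨P, hP0, hPa, hPs⟩ := key B hBB
  obtain ⟨P', hP0', hPa', hPs'⟩ := key C hCC
  have h1 : ∀ i v, C i * P v = y ^ wform ht c (Pi.single i 1) v * (P v * C i) := fun i v => by
    refine pi_int_induction
      (p := fun v => C i * P v = y ^ wform ht c (Pi.single i 1) v * (P v * C i)) ?_ ?_ ?_ ?_ v
    · simp [hP0, wform_zero_right]
    · intro u v hu hv
      rw [hPa, ← mul_assoc, hu, mul_assoc, mul_assoc, hv, ← mul_assoc (P u), hyz,
        wform_add_right, zpow_add]
      simp only [mul_assoc]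
    · intro u hu
      have hn : P (-u) = (P u)⁻¹ := by
        rw [eq_inv_iff_mul_eq_one, ← hPa, neg_add_cancel, hP0]
      rw [hn, wform_neg_right, zpow_neg, eq_inv_mul_iff_mul_eq, eq_inv_mul_iff_mul_eq,
        ← mul_assoc, ← mul_assoc, hyz, mul_assoc _ (P u), ← hu, mul_inv_cancel_right]
    · intro j
      rw [hPs, hCB]
  have h2 : ∀ u v, P' u * P v = y ^ wform ht c u v * (P v * P' u) := fun u v => by
    refine pi_int_induction
      (p := fun u => P' u * P v = y ^ wform ht c u v * (P v * P' u)) ?_ ?_ ?_ ?_ u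
    · simp [hP0', wform_zero_left]
    · intro u u' hu hu'
      rw [hPa', mul_assoc, hu', ← mul_assoc, hyz, mul_assoc, ← mul_assoc (P' u), hu,
        wform_add_left, add_comm, zpow_add]
      simp only [mul_assoc]
    · intro u hu
      have hn : P' (-u) = (P' u)⁻¹ := by
        rw [eq_inv_iff_mul_eq_one, ← hPa', neg_add_cancel, hP0']
      rw [hn, wform_neg_left, zpow_neg, eq_inv_mul_iff_mul_eq, ← mul_assoc, ← hyz, mul_assoc,
        inv_mul_eq_iff_eq_mul, ← mul_assoc, eq_mul_inv_iff_mul_eq, hu, mul_assoc]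
    · intro i
      rw [hPs', h1]
  refine ⟨fun u => P u * P' u, fun u v => ?_, fun i => ?_⟩
  · simp only [hPa, hPa']
    rw [mul_assoc, ← mul_assoc (P' u), h2, ← mul_assoc, ← mul_assoc, hyz]
    simp only [mul_assoc]
  · simp only [hPs, hPs', B, C]
    split_ifs <;> simp

end NormalForm


/-! ### Block diagonal unitary matrices and conjugacy classes -/

section Blocks

/-- Two families whose fibres have the same cardinality differ by a permutation. -/
theorem exists_equiv_of_card_fiber {ι κ β : Type*} [Fintype ι] [Fintype κ] [DecidableEq β]
    (f : ι → β) (g : κ → β)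
    (h : ∀ b, Fintype.card {i // f i = b} = Fintype.card {i // g i = b}) :
    ∃ σ : ι ≃ κ, ∀ i, g (σ i) = f i :=
  ⟨Equiv.ofFiberEquiv fun b => Fintype.equivOfCardEq (h b), fun i => by
    exact Equiv.ofFiberEquiv_map _ i⟩

theorem exists_perm_of_prod_X_sub_C_eq {ι : Type*} [Fintype ι] (f g : ι → ℂ)
    (h : ∏ i, (Polynomial.X - Polynomial.C (f i)) = ∏ i, (Polynomial.X - Polynomial.C (g i))) :
    ∃ σ : Equiv.Perm ι, ∀ i, g (σ i) = f i := by
  classical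
  have key : ∀ f : ι → ℂ, (∏ i, (Polynomial.X - Polynomial.C (f i))).roots =
      Finset.univ.val.map f := fun f => by
    rw [← Polynomial.roots_multiset_prod_X_sub_C (Finset.univ.val.map f), Multiset.map_map]
    rfl
  have h1 := congrArg Polynomial.roots h
  rw [key, key] at h1
  refine exists_equiv_of_card_fiber f g fun b => ?_
  have h2 := congrArg (Multiset.count b) h1
  rw [Multiset.count_map, Multiset.count_map] at h2
  rw [Fintype.card_subtype, Fintype.card_subtype, Finset.card_def, Finset.card_def,
    Finset.filter_val, Finset.filter_val]
  simpa only [eq_comm] using h2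

theorem charpoly_monoU_one {m : ℕ} (d : Fin m → Circle) :
    ((monoU 1 d : U m) : Matrix (Fin m) (Fin m) ℂ).charpoly =
      ∏ i, (Polynomial.X - Polynomial.C (d i : ℂ)) := by
  rw [monoU_one, Matrix.charpoly_diagonal]

/-- Unitary matrices with the same spectrum are unitarily conjugate. -/
theorem exists_conj_of_charpoly_eq {m : ℕ} (X : U m) (d : Fin m → Circle)
    (h : (X : Matrix (Fin m) (Fin m) ℂ).charpoly =
      ∏ i, (Polynomial.X - Polynomial.C (d i : ℂ))) :
    ∃ g : U m, X = g * monoU 1 d * g⁻¹ := by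
  obtain ⟨k, d', rfl⟩ := exists_conj_diagonal X
  rw [charpoly_conj, charpoly_monoU_one] at h
  obtain ⟨σ, hσ⟩ := exists_perm_of_prod_X_sub_C_eq _ _ h.symm
  refine ⟨k * monoU σ 1, ?_⟩
  have : monoU 1 d' * monoU σ 1 = monoU σ 1 * monoU 1 d := by
    rw [monoU_mul, monoU_mul, one_mul, mul_one]
    congr 1
    funext q
    simpa using Circle.ext (hσ q)
  rw [mul_assoc k (monoU σ 1), ← this, mul_inv_rev, ← mul_assoc, ← mul_assoc,
    mul_inv_cancel_right]

theorem eq_scalarU_of_charpoly {m : ℕ} (X : U m) (z : Circle)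
    (h : (X : Matrix (Fin m) (Fin m) ℂ).charpoly =
      (Polynomial.X - Polynomial.C (z : ℂ)) ^ m) : X = scalarU z := by
  obtain ⟨g, rfl⟩ := exists_conj_of_charpoly_eq X (fun _ => z) (by simpa using h)
  rw [← scalarU, ← scalarU_comm, mul_inv_cancel_right]

theorem charpoly_scalarU {m : ℕ} (z : Circle) :
    ((scalarU z : U m) : Matrix (Fin m) (Fin m) ℂ).charpoly =
      (Polynomial.X - Polynomial.C (z : ℂ)) ^ m := by
  simp [scalarU, charpoly_monoU_one]

variable {s : ℕ} (mu : Fin s → ℕ)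

theorem coe_blockEmb (M : ∀ j, U (mu j)) :
    (blockEmb mu M : Matrix (Fin (∑ j, mu j)) (Fin (∑ j, mu j)) ℂ) =
      Matrix.reindex finSigmaFinEquiv finSigmaFinEquiv
        (Matrix.blockDiagonal' fun j => (M j : Matrix (Fin (mu j)) (Fin (mu j)) ℂ)) := rfl

theorem blockEmb_injective : Function.Injective (blockEmb mu) := fun M N h => by
  have h1 := congrArg Subtype.val h
  rw [coe_blockEmb, coe_blockEmb] at h1
  have h2 := Matrix.blockDiagonal'_injective ((Matrix.reindex _ _).injective h1)
  exact funext fun j => Subtype.ext (congrFun h2 j)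

theorem continuous_blockEmb : Continuous (blockEmb mu) := by
  refine Continuous.subtype_mk ?_ _
  exact (Continuous.matrix_blockDiagonal' (continuous_pi fun j =>
    continuous_subtype_val.comp (continuous_apply j))).matrix_reindex _ _

/-- The block scalar matrix with eigenvalue `lam j` of multiplicity `mu j`. -/
def blockScalar (lam : Fin s → Circle) : U (∑ j, mu j) := blockEmb mu fun j => scalarU (lam j)

theorem blockScalar_eq (lam : Fin s → Circle) :
    blockScalar mu lam = monoU 1 fun p => lam (finSigmaFinEquiv.symm p).1 := by
  refine Subtype.ext ?_
  rw [blockScalar, coe_blockEmb, monoU_one]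
  simp only [scalarU, monoU_one]
  rw [Matrix.blockDiagonal'_diagonal, Matrix.reindex_apply, Matrix.submatrix_diagonal_equiv]
  rfl

theorem charpoly_blockScalar (lam : Fin s → Circle) :
    (blockScalar mu lam : Matrix (Fin (∑ j, mu j)) (Fin (∑ j, mu j)) ℂ).charpoly =
      ∏ j, (Polynomial.X - Polynomial.C (lam j : ℂ)) ^ mu j := by
  rw [blockScalar_eq, charpoly_monoU_one,
    ← finSigmaFinEquiv.prod_comp fun p =>
      Polynomial.X - Polynomial.C (lam (finSigmaFinEquiv.symm p).1 : ℂ), Fintype.prod_sigma]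
  simp

theorem exists_conj_blockScalar (lam : Fin s → Circle) (X : U (∑ j, mu j))
    (h : (X : Matrix (Fin (∑ j, mu j)) (Fin (∑ j, mu j)) ℂ).charpoly =
      ∏ j, (Polynomial.X - Polynomial.C (lam j : ℂ)) ^ mu j) :
    ∃ g, X = g * blockScalar mu lam * g⁻¹ := by
  rw [blockScalar_eq]
  refine exists_conj_of_charpoly_eq X _ ?_
  rw [h, ← charpoly_blockScalar, blockScalar_eq, charpoly_monoU_one]

/-- The centralizer of `blockScalar` consists of block diagonal matrices. -/
theorem mem_range_blockEmb (lam : Fin s → Circle) (hlam : Function.Injective lam)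
    (g : U (∑ j, mu j)) (h : g * blockScalar mu lam = blockScalar mu lam * g) :
    ∃ M, blockEmb mu M = g := by
  set G := Matrix.reindex finSigmaFinEquiv.symm finSigmaFinEquiv.symm
    (g : Matrix (Fin (∑ j, mu j)) (Fin (∑ j, mu j)) ℂ) with hG
  have hoff : ∀ p q : Σ j, Fin (mu j), p.1 ≠ q.1 → G p q = 0 := fun p q hpq => by
    rw [blockScalar_eq] at h
    have h1 := congrFun (congrFun (congrArg Subtype.val h) (finSigmaFinEquiv p))
      (finSigmaFinEquiv q)
    rw [Submonoid.coe_mul, Submonoid.coe_mul, mul_monoU_apply, monoU_one,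
      Matrix.diagonal_mul] at h1
    simp only [Equiv.symm_apply_apply, Equiv.Perm.one_apply] at h1
    rw [← sub_eq_zero, ← sub_mul] at h1
    exact (mul_eq_zero.1 h1).resolve_left fun h2 =>
      hpq (hlam (Circle.ext (sub_eq_zero.1 h2))).symm
  have hGb : Matrix.blockDiagonal' (fun j => Matrix.blockDiag' G j) = G := by
    ext ⟨i, p⟩ ⟨j, q⟩
    by_cases hij : i = j
    · subst hij
      rw [Matrix.blockDiagonal'_apply_eq]
      rfl
    · rw [Matrix.blockDiagonal'_apply_ne _ _ _ hij]
      exact (hoff _ _ hij).symm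
  have hGu : G.conjTranspose * G = 1 := by
    rw [hG, Matrix.conjTranspose_reindex, Matrix.reindex_apply, Matrix.reindex_apply,
      Matrix.submatrix_mul_equiv, ← Matrix.star_eq_conjTranspose,
      Matrix.mem_unitaryGroup_iff'.1 g.2, Matrix.submatrix_one_equiv]
  rw [← hGb, Matrix.blockDiagonal'_conjTranspose, ← Matrix.blockDiagonal'_mul] at hGu
  have hone : Matrix.blockDiagonal' (fun j => (1 : Matrix (Fin (mu j)) (Fin (mu j)) ℂ)) = 1 :=
    Matrix.blockDiagonal'_one
  have hu := Matrix.blockDiagonal'_injective (hGu.trans hone.symm)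
  refine ⟨fun j => ⟨Matrix.blockDiag' G j, Matrix.mem_unitaryGroup_iff'.2 (congrFun hu j)⟩,
    Subtype.ext ?_⟩
  rw [coe_blockEmb]
  change Matrix.reindex _ _ (Matrix.blockDiagonal' fun j => Matrix.blockDiag' G j) = _
  rw [hGb, hG]
  ext p q
  simp

end Blocks

/-! ### Topology of the spaces of homomorphisms -/

section Topology

instance compactSpace_U (m : ℕ) : CompactSpace (U m) := by
  refine isCompact_iff_compactSpace.1 ?_
  have hK : IsCompact (Set.univ.pi fun _ : Fin m => Set.univ.pi fun _ : Fin m =>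
      Metric.closedBall (0 : ℂ) 1) :=
    isCompact_univ_pi fun _ => isCompact_univ_pi fun _ => isCompact_closedBall _ _
  exact hK.of_isClosed_subset (isClosed_unitary (R := Matrix (Fin m) (Fin m) ℂ))
    fun A hA i _ j _ => mem_closedBall_zero_iff.2 (entry_norm_bound_of_unitary hA i j)

theorem isClosed_charpoly_eq (m : ℕ) (p : Polynomial ℂ) :
    IsClosed {X : U m | (X : Matrix (Fin m) (Fin m) ℂ).charpoly = p} := by
  have : {X : U m | (X : Matrix (Fin m) (Fin m) ℂ).charpoly = p} =
      ⋂ z : ℂ, {X : U m | (Matrix.scalar (Fin m) z - (X : Matrix (Fin m) (Fin m) ℂ)).det =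
        p.eval z} := by
    ext X
    simp only [Set.mem_ofPred_eq, Set.mem_iInter, ← Matrix.eval_charpoly]
    exact ⟨fun h z => by rw [h], Polynomial.funext⟩
  rw [this]
  exact isClosed_iInter fun z => isClosed_eq
    (Continuous.matrix_det (continuous_const.sub continuous_subtype_val)) continuous_const

variable (Γ : Type*) [Group Γ] (x : Γ) (m : ℕ) (p : Polynomial ℂ)

theorem isInducing_homP : Topology.IsInducing fun (f : HomP Γ x m p) (γ : Γ) => f.1 γ :=
  (Topology.IsInducing.mk rfl : Topology.IsInducing fun (f : Γ →* U m) (γ : Γ) => f γ).comp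
    Topology.IsInducing.subtypeVal

theorem isClosedEmbedding_homP :
    Topology.IsClosedEmbedding fun (f : HomP Γ x m p) (γ : Γ) => f.1 γ := by
  refine ⟨⟨isInducing_homP Γ x m p, fun f g h => Subtype.ext (MonoidHom.ext (congrFun h))⟩, ?_⟩
  have : Set.range (fun (f : HomP Γ x m p) (γ : Γ) => f.1 γ) =
      (⋂ a : Γ, ⋂ b : Γ, {φ : Γ → U m | φ (a * b) = φ a * φ b}) ∩
        {φ | (φ x : Matrix (Fin m) (Fin m) ℂ).charpoly = p} := by
    ext φ
    simp only [Set.mem_range, Set.mem_inter_iff, Set.mem_iInter, Set.mem_ofPred_eq]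
    constructor
    · rintro ⟨f, rfl⟩
      exact ⟨fun a b => map_mul f.1 a b, f.2⟩
    · rintro ⟨h1, h2⟩
      exact ⟨⟨MonoidHom.mk' φ h1, h2⟩, rfl⟩
  rw [this]
  have h1 : ∀ a b : Γ, IsClosed {φ : Γ → U m | φ (a * b) = φ a * φ b} := fun a b =>
    isClosed_eq (continuous_apply (a * b)) ((continuous_apply a).mul (continuous_apply b))
  exact (isClosed_iInter fun a => isClosed_iInter fun b => h1 a b).inter
    ((isClosed_charpoly_eq m p).preimage (continuous_apply (A := fun _ : Γ => U m) x))

instance : CompactSpace (HomP Γ x m p) := (isClosedEmbedding_homP Γ x m p).compactSpace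

instance : T2Space (HomP Γ x m p) := (isClosedEmbedding_homP Γ x m p).t2Space

instance : T2Space (UP m p) := inferInstanceAs (T2Space
  {X : U m // (X : Matrix (Fin m) (Fin m) ℂ).charpoly = p})

variable {Γ x m p}

theorem continuous_homP_apply (γ : Γ) : Continuous fun f : HomP Γ x m p => f.1 γ :=
  (continuous_apply γ).comp (isInducing_homP Γ x m p).continuous

theorem continuous_homP_iff {Y : Type*} [TopologicalSpace Y] {φ : Y → HomP Γ x m p} :
    Continuous φ ↔ ∀ γ, Continuous fun y => (φ y).1 γ := by
  rw [(isInducing_homP Γ x m p).continuous_iff, continuous_pi_iff]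
  rfl

theorem homP_smul_apply (g : U m) (f : HomP Γ x m p) (γ : Γ) :
    (g • f).1 γ = g * f.1 γ * g⁻¹ := rfl

theorem continuous_res : Continuous (res Γ x m p) :=
  Continuous.subtype_mk (continuous_homP_apply x) _

instance : ContinuousSMul (U m) (HomP Γ x m p) :=
  ⟨continuous_homP_iff.2 fun γ => (continuous_fst.mul
    ((continuous_homP_apply γ).comp continuous_snd)).mul continuous_fst.inv⟩

end Topology


/-! ### Isotypic homomorphisms and almost commuting tuples -/

section AlmostCommutingTuples

variable {n t : ℕ} {ht : 2 * t ≤ n} {c : Fin t → ℕ} {Γ : Type*} [Group Γ] {x : Γ}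
  {s : (Fin n → ℤ) → Γ}

theorem toCircle_logQ (z : Circle) : AddCircle.toCircle (logQ z) = z := by
  rw [logQ, AddCircle.toCircle_apply_mk, div_one, mul_div_cancel₀ _ Real.two_pi_pos.ne',
    Circle.exp_arg]

variable (ht c)

theorem toCircle_Dmat (z : Circle) (i j : Fin n) :
    AddCircle.toCircle (Dmat n (fun i => -((c i : ℤ) • logQ z)) i j) =
      z ^ (wform ht c (Pi.single i 1) (Pi.single j 1) -
        wform ht c (Pi.single j 1) (Pi.single i 1)) := by
  have hz : ∀ k : ℕ, AddCircle.toCircle ((k : ℤ) • logQ z) = z ^ (k : ℤ) := fun k => by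
    rw [AddCircle.toCircle_zsmul, toCircle_logQ]
  rw [Dmat]
  split_ifs with h1 h2
  · have e1 : wform ht c (Pi.single i 1) (Pi.single j 1) = 0 :=
      wform_single_of_ne ht c fun k hk => by have := k.2; omega
    have e2 := wform_single_single ht c ⟨j, h1.1⟩
    have e3 : (⟨t + j, by omega⟩ : Fin n) = i := Fin.ext (by simp; omega)
    simp only [e3, Fin.eta] at e2
    rw [e1, e2, zero_sub, AddCircle.toCircle_neg, hz, zpow_neg]
  · have e1 : wform ht c (Pi.single j 1) (Pi.single i 1) = 0 :=
      wform_single_of_ne ht c fun k hk => by have := k.2; omega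
    have e2 := wform_single_single ht c ⟨i, h2.1⟩
    have e3 : (⟨t + i, by omega⟩ : Fin n) = j := Fin.ext (by simp; omega)
    simp only [e3, Fin.eta] at e2
    rw [e1, e2, sub_zero, neg_neg, hz]
  · rw [wform_single_of_ne ht c fun k hk => h2 ⟨by have := k.2; omega, by omega⟩,
      wform_single_of_ne ht c fun k hk => h1 ⟨by have := k.2; omega, by omega⟩]
    simp

variable {ht c}

theorem coe_comm_eq_iff {m : ℕ} (a b : U m) (z : Circle) :
    (comm a b : Matrix (Fin m) (Fin m) ℂ) = (z : ℂ) • (1 : Matrix (Fin m) (Fin m) ℂ) ↔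
      a * b = scalarU z * (b * a) := by
  rw [← coe_scalarU, Subtype.coe_inj, comm, mul_inv_eq_iff_eq_mul, mul_inv_eq_iff_eq_mul,
    mul_assoc]

theorem isDCommuting_iff (ht : 2 * t ≤ n) {m : ℕ} (z : Circle) (A : Fin n → U m) :
    IsDCommuting (Dmat n fun i => -((c i : ℤ) • logQ z)) A ↔
      ∀ i j, A i * A j = scalarU z ^ (wform ht c (Pi.single i 1) (Pi.single j 1) -
        wform ht c (Pi.single j 1) (Pi.single i 1)) * (A j * A i) := by
  refine forall_congr' fun i => forall_congr' fun j => ?_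
  rw [coe_comm_eq_iff, toCircle_Dmat ht, scalarU_zpow]

theorem IsDCommuting.isAlmostCommuting {m : ℕ} {D : Matrix (Fin n) (Fin n) UnitAddCircle}
    {A : Fin n → U m} (h : IsDCommuting D A) : IsAlmostCommuting A := fun i j => by
  rw [Subgroup.mem_center_iff]
  have : comm (A i) (A j) = scalarU (AddCircle.toCircle (D i j)) :=
    Subtype.ext ((h i j).trans (coe_scalarU _).symm)
  intro g
  rw [this, scalarU_comm]

instance (m : ℕ) (D : Matrix (Fin n) (Fin n) UnitAddCircle) : T2Space (BD m D) :=
  inferInstanceAs (T2Space {A : Fin n → U m // IsAlmostCommuting A ∧ IsDCommuting D A})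

theorem homP_map_central {m : ℕ} {z : Circle}
    (f : HomP Γ x m ((Polynomial.X - Polynomial.C (z : ℂ)) ^ m)) : f.1 x = scalarU z :=
  eq_scalarU_of_charpoly _ _ f.2

/-- Evaluation of homomorphisms with `f x = z` at the lifts of the basis vectors is a
homeomorphism onto the space of almost commuting tuples. -/
def IsNormalForm.homeoBD (hs : IsNormalForm x ht c s) (m : ℕ) (z : Circle) :
    HomP Γ x m ((Polynomial.X - Polynomial.C (z : ℂ)) ^ m) ≃ₜ
      BD m (Dmat n fun i => -((c i : ℤ) • logQ z)) :=
  have hD : ∀ f : HomP Γ x m ((Polynomial.X - Polynomial.C (z : ℂ)) ^ m),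
      IsDCommuting (Dmat n fun i => -((c i : ℤ) • logQ z))
        fun i : Fin n => f.1 (s (Pi.single i 1)) := fun f => by
    rw [isDCommuting_iff ht]
    intro i j
    rw [← homP_map_central f]
    exact hs.map_single_comm f.1 _ _
  Continuous.homeoOfEquivCompactToT2
    (f := Equiv.ofBijective (fun f => ⟨fun i => f.1 (s (Pi.single i 1)),
      (hD f).isAlmostCommuting, hD f⟩) ⟨fun f g h => by
        refine Subtype.ext (hs.hom_ext ?_ fun i => congrFun (congrArg Subtype.val h) i)
        rw [homP_map_central, homP_map_central], fun A => by
        obtain ⟨F, hF, hFA⟩ := exists_extension_of_comm ht c (scalarU z : U m)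
          (fun g => (scalarU_comm z g).symm) A.1 ((isDCommuting_iff ht z A.1).1 A.2.2)
        obtain ⟨f, hfx, hf⟩ := hs.exists_hom _ F (fun g => (scalarU_comm z g).symm) hF
        refine ⟨⟨f, by rw [hfx, charpoly_scalarU]⟩, Subtype.ext (funext fun i => ?_)⟩
        exact (hf _).trans (hFA i)⟩)
    (Continuous.subtype_mk (continuous_pi fun _ => continuous_homP_apply _) _)

theorem IsNormalForm.homeoBD_smul (hs : IsNormalForm x ht c s) (m : ℕ) (z : Circle) (g : U m)
    (f : HomP Γ x m ((Polynomial.X - Polynomial.C (z : ℂ)) ^ m)) :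
    hs.homeoBD m z (g • f) = g • hs.homeoBD m z f := rfl

end AlmostCommutingTuples

/-! ### The balanced product decomposition -/

section Decomposition

/-- An equivariant homeomorphism of fibres induces a homeomorphism of balanced products. -/
def BalancedProduct.congr {G H : Type*} [Group G] [Group H] [TopologicalSpace G] (ι : H →* G)
    {F F' : Type*} [MulAction H F] [MulAction H F'] [TopologicalSpace F] [TopologicalSpace F']
    (Ξ : F ≃ₜ F') (hΞ : ∀ (h : H) y, Ξ (h • y) = h • Ξ y) :
    BalancedProduct ι F ≃ₜ BalancedProduct ι F' :=
  have hΞ' : ∀ (h : H) y, Ξ.symm (h • y) = h • Ξ.symm y := fun h y => by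
    rw [Homeomorph.symm_apply_eq, hΞ, Homeomorph.apply_symm_apply]
  { toFun := Quotient.map (fun a => (a.1, Ξ a.2)) (by
      rintro a b ⟨h, rfl⟩
      exact ⟨h, by simp [hΞ]⟩)
    invFun := Quotient.map (fun a => (a.1, Ξ.symm a.2)) (by
      rintro a b ⟨h, rfl⟩
      exact ⟨h, by simp [hΞ']⟩)
    left_inv := fun a => by
      induction a using Quotient.inductionOn with
      | h a => exact congrArg (Quotient.mk _) (by simp)
    right_inv := fun a => by
      induction a using Quotient.inductionOn with
      | h a => exact congrArg (Quotient.mk _) (by simp)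
    continuous_toFun := continuous_quot_lift _ (continuous_quot_mk.comp
      (continuous_fst.prodMk (Ξ.continuous.comp continuous_snd)))
    continuous_invFun := continuous_quot_lift _ (continuous_quot_mk.comp
      (continuous_fst.prodMk (Ξ.symm.continuous.comp continuous_snd))) }

theorem BalancedProduct.congr_smul {G H : Type*} [Group G] [Group H] [TopologicalSpace G]
    (ι : H →* G) {F F' : Type*} [MulAction H F] [MulAction H F'] [TopologicalSpace F]
    [TopologicalSpace F'] (Ξ : F ≃ₜ F') (hΞ : ∀ (h : H) y, Ξ (h • y) = h • Ξ y) (g : G)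
    (a : BalancedProduct ι F) :
    BalancedProduct.congr ι Ξ hΞ (g • a) = g • BalancedProduct.congr ι Ξ hΞ a := by
  induction a using Quotient.inductionOn with
  | h a => rfl

theorem BalancedProduct.collapse_congr {G H : Type*} [Group G] [Group H] [TopologicalSpace G]
    (ι : H →* G) {F F' : Type*} [MulAction H F] [MulAction H F'] [TopologicalSpace F]
    [TopologicalSpace F'] (Ξ : F ≃ₜ F') (hΞ : ∀ (h : H) y, Ξ (h • y) = h • Ξ y)
    (a : BalancedProduct ι F) :
    collapse ι F' (BalancedProduct.congr ι Ξ hΞ a) = collapse ι F a := by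
  induction a using Quotient.inductionOn with
  | h a => rfl

variable {s : ℕ} (mu : Fin s → ℕ) (lam : Fin s → Circle) {p : Polynomial ℂ}
  (hp : p = ∏ j, (Polynomial.X - Polynomial.C (lam j : ℂ)) ^ mu j)

theorem conj_blockScalar_eq_iff (hlam : Function.Injective lam) (g h : U (∑ j, mu j)) :
    g * blockScalar mu lam * g⁻¹ = h * blockScalar mu lam * h⁻¹ ↔
      g⁻¹ * h ∈ (blockEmb mu).range := by
  have : g * blockScalar mu lam * g⁻¹ = h * blockScalar mu lam * h⁻¹ ↔
      (g⁻¹ * h) * blockScalar mu lam = blockScalar mu lam * (g⁻¹ * h) := by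
    constructor
    · intro h1
      calc g⁻¹ * h * blockScalar mu lam = g⁻¹ * (h * blockScalar mu lam * h⁻¹) * h := by group
        _ = blockScalar mu lam * (g⁻¹ * h) := by rw [← h1]; group
    · intro h1
      calc g * blockScalar mu lam * g⁻¹
          = g * (blockScalar mu lam * (g⁻¹ * h)) * h⁻¹ := by group
        _ = h * blockScalar mu lam * h⁻¹ := by rw [← h1]; group
  rw [this]
  constructor
  · exact mem_range_blockEmb mu lam hlam _
  · rintro ⟨M, hM⟩
    rw [← hM, blockScalar, ← map_mul, ← map_mul]
    congr 1
    funext j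
    exact (scalarU_comm _ _).symm

/-- The orbit map of `blockScalar` on cosets. -/
def flagMap (hlam : Function.Injective lam) :
    U (∑ j, mu j) ⧸ (blockEmb mu).range → UP (∑ j, mu j) p :=
  Quotient.lift (fun g : U (∑ j, mu j) => (⟨g * blockScalar mu lam * g⁻¹, by
      rw [charpoly_conj, charpoly_blockScalar, hp]⟩ : UP (∑ j, mu j) p))
    fun g h hgh => Subtype.ext ((conj_blockScalar_eq_iff mu lam hlam g h).2
      (QuotientGroup.leftRel_apply.1 hgh))

theorem flagMap_bijective (hlam : Function.Injective lam) :
    Function.Bijective (flagMap mu lam hp hlam) := by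
  refine ⟨fun a b => ?_, fun X => ?_⟩
  · induction a using Quotient.inductionOn with
    | h a =>
      induction b using Quotient.inductionOn with
      | h b =>
        intro h
        exact Quotient.sound (QuotientGroup.leftRel_apply.2
          ((conj_blockScalar_eq_iff mu lam hlam a b).1 (congrArg Subtype.val h)))
  · obtain ⟨g, hg⟩ := exists_conj_blockScalar mu lam X.1 (X.2.trans hp)
    exact ⟨Quotient.mk _ g, Subtype.ext hg.symm⟩

/-- The flag manifold as a conjugacy class. -/
def flagHomeo (hlam : Function.Injective lam) :
    U (∑ j, mu j) ⧸ (blockEmb mu).range ≃ₜ UP (∑ j, mu j) p :=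
  Continuous.homeoOfEquivCompactToT2
    (f := Equiv.ofBijective _ (flagMap_bijective mu lam hp hlam))
    (continuous_quot_lift _ (Continuous.subtype_mk
      ((continuous_id.mul continuous_const).mul continuous_inv) _))

set_option synthInstance.maxHeartbeats 100000 in
theorem flagHomeo_smul (hlam : Function.Injective lam) (g : U (∑ j, mu j))
    (a : U (∑ j, mu j) ⧸ (blockEmb mu).range) :
    flagHomeo mu lam hp hlam (g • a) = g • flagHomeo mu lam hp hlam a := by
  induction a using Quotient.inductionOn with
  | h a =>
    refine Subtype.ext ?_
    change (g * a) * blockScalar mu lam * (g * a)⁻¹ = g * (a * blockScalar mu lam * a⁻¹) * g⁻¹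
    group

variable (Γ : Type*) [Group Γ] (x : Γ)

/-- The block sum of isotypic homomorphisms. -/
def blockRep (φ : ∀ j, HomP Γ x (mu j) ((Polynomial.X - Polynomial.C (lam j : ℂ)) ^ mu j)) :
    HomP Γ x (∑ j, mu j) p :=
  ⟨(blockEmb mu).comp (MonoidHom.pi fun j => (φ j).1), by
    have : (fun j => (φ j).1 x) = fun j => scalarU (lam j) :=
      funext fun j => homP_map_central (φ j)
    rw [hp, ← charpoly_blockScalar, blockScalar, ← this]
    rfl⟩

variable {Γ x}

theorem blockRep_apply
    (φ : ∀ j, HomP Γ x (mu j) ((Polynomial.X - Polynomial.C (lam j : ℂ)) ^ mu j)) (γ : Γ) :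
    (blockRep mu lam hp Γ x φ).1 γ = blockEmb mu fun j => (φ j).1 γ := rfl

theorem blockRep_central
    (φ : ∀ j, HomP Γ x (mu j) ((Polynomial.X - Polynomial.C (lam j : ℂ)) ^ mu j)) :
    (blockRep mu lam hp Γ x φ).1 x = blockScalar mu lam := by
  rw [blockRep_apply, blockScalar]
  exact congrArg _ (funext fun j => homP_map_central (φ j))

theorem blockRep_smul (h : ∀ j, U (mu j))
    (φ : ∀ j, HomP Γ x (mu j) ((Polynomial.X - Polynomial.C (lam j : ℂ)) ^ mu j)) :
    blockRep mu lam hp Γ x (h • φ) = blockEmb mu h • blockRep mu lam hp Γ x φ := by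
  refine Subtype.ext (MonoidHom.ext fun γ => ?_)
  rw [homP_smul_apply, blockRep_apply, blockRep_apply, ← map_inv, ← map_mul, ← map_mul]
  rfl

theorem blockRep_injective : Function.Injective (blockRep mu lam hp Γ x) := fun φ φ' h =>
  funext fun j => Subtype.ext (MonoidHom.ext fun γ => by
    have h1 := DFunLike.congr_fun (congrArg Subtype.val h) γ
    rw [blockRep_apply, blockRep_apply] at h1
    exact congrFun (blockEmb_injective mu h1) j)

theorem continuous_blockRep : Continuous (blockRep mu lam hp Γ x) :=
  continuous_homP_iff.2 fun γ => (continuous_blockEmb mu).comp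
    (continuous_pi fun j => (continuous_homP_apply γ).comp (continuous_apply j))

/-- A homomorphism sending the central element `x` to a block scalar matrix is a block sum, since
its values lie in the centralizer of that matrix. -/
theorem exists_blockRep_eq (hx : ∀ γ, γ * x = x * γ) (hlam : Function.Injective lam)
    (f : HomP Γ x (∑ j, mu j) p) (hf : f.1 x = blockScalar mu lam) :
    ∃ φ, blockRep mu lam hp Γ x φ = f := by
  have h1 : ∀ γ, ∃ M, blockEmb mu M = f.1 γ := fun γ =>
    mem_range_blockEmb mu lam hlam _ (by rw [← hf, ← map_mul, hx, map_mul])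
  choose M hM using h1
  have hMx : M x = fun j => scalarU (lam j) := blockEmb_injective mu (by rw [hM, hf, blockScalar])
  let F : Γ →* (∀ j, U (mu j)) := MonoidHom.mk' M fun a b =>
    blockEmb_injective mu (by rw [map_mul, hM, hM, hM, map_mul])
  refine ⟨fun j => ⟨(Pi.evalMonoidHom _ j).comp F, ?_⟩, Subtype.ext (MonoidHom.ext fun γ => ?_)⟩
  · change ((M x j : U (mu j)) : Matrix (Fin (mu j)) (Fin (mu j)) ℂ).charpoly = _
    rw [hMx, charpoly_scalarU]
  · exact hM γ

theorem smul_blockRep_eq_iff (hlam : Function.Injective lam) (g g' : U (∑ j, mu j))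
    (φ φ' : ∀ j, HomP Γ x (mu j) ((Polynomial.X - Polynomial.C (lam j : ℂ)) ^ mu j)) :
    g • blockRep mu lam hp Γ x φ = g' • blockRep mu lam hp Γ x φ' ↔
      ∃ h : ∀ j, U (mu j), g' = g * (blockEmb mu h)⁻¹ ∧ φ' = h • φ := by
  constructor
  · intro h
    have h1 := DFunLike.congr_fun (congrArg Subtype.val h) x
    rw [homP_smul_apply, homP_smul_apply, blockRep_central, blockRep_central,
      conj_blockScalar_eq_iff mu lam hlam] at h1
    obtain ⟨M, hM⟩ := h1
    refine ⟨M⁻¹, by rw [map_inv, inv_inv, hM, mul_inv_cancel_left], ?_⟩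
    apply blockRep_injective mu lam hp
    rw [blockRep_smul, map_inv, hM, mul_inv_rev, inv_inv, mul_smul, h, inv_smul_smul]
  · rintro ⟨h, rfl, rfl⟩
    rw [blockRep_smul, mul_smul, inv_smul_smul]

/-- The space of homomorphisms as a balanced product. -/
def balancedHomeo (hx : ∀ γ, γ * x = x * γ) (hlam : Function.Injective lam) :
    BalancedProduct (blockEmb mu)
      (∀ j, HomP Γ x (mu j) ((Polynomial.X - Polynomial.C (lam j : ℂ)) ^ mu j)) ≃ₜ
      HomP Γ x (∑ j, mu j) p :=
  haveI : CompactSpace (BalancedProduct (blockEmb mu)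
      (∀ j, HomP Γ x (mu j) ((Polynomial.X - Polynomial.C (lam j : ℂ)) ^ mu j))) :=
    Quotient.compactSpace
  Continuous.homeoOfEquivCompactToT2
    (f := Equiv.ofBijective (Quotient.lift (fun a => a.1 • blockRep mu lam hp Γ x a.2)
        (fun a b => by
          rintro ⟨h, rfl⟩
          exact (smul_blockRep_eq_iff mu lam hp hlam _ _ _ _).2 ⟨h, rfl, rfl⟩))
      ⟨fun a b => by
        induction a using Quotient.inductionOn with
        | h a =>
        induction b using Quotient.inductionOn with
        | h b =>
        intro h
        obtain ⟨k, h1, h2⟩ := (smul_blockRep_eq_iff mu lam hp hlam _ _ _ _).1 h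
        exact Quotient.sound ⟨k, Prod.ext h1 h2⟩,
      fun f => by
        obtain ⟨g, hg⟩ := exists_conj_blockScalar mu lam (f.1 x) (f.2.trans hp)
        obtain ⟨φ, hφ⟩ := exists_blockRep_eq mu lam hp hx hlam (g⁻¹ • f) (by
          rw [homP_smul_apply, hg]
          group)
        exact ⟨Quotient.mk _ (g, φ), (congrArg (g • ·) hφ).trans (smul_inv_smul g f)⟩⟩)
    (continuous_quot_lift _ (continuous_fst.smul
      ((continuous_blockRep mu lam hp).comp continuous_snd)))

theorem balancedHomeo_smul (hx : ∀ γ, γ * x = x * γ) (hlam : Function.Injective lam)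
    (g : U (∑ j, mu j)) (a) :
    balancedHomeo mu lam hp hx hlam (g • a) = g • balancedHomeo mu lam hp hx hlam a := by
  induction a using Quotient.inductionOn with
  | h a => exact mul_smul g a.1 (blockRep mu lam hp Γ x a.2)

theorem flagHomeo_collapse (hx : ∀ γ, γ * x = x * γ) (hlam : Function.Injective lam) (a) :
    flagHomeo mu lam hp hlam (collapse _ _ a) =
      res Γ x _ p (balancedHomeo mu lam hp hx hlam a) := by
  induction a using Quotient.inductionOn with
  | h a =>
    refine Subtype.ext ?_
    change a.1 * blockScalar mu lam * a.1⁻¹ = a.1 * (blockRep mu lam hp Γ x a.2).1 x * a.1⁻¹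
    rw [blockRep_central]

end Decomposition


/-! ### Polar decomposition and local sections over the flag manifold -/

section Polar

open scoped Matrix.Norms.L2Operator MatrixOrder

variable {m : ℕ}

theorem isStrictlyPositive_star_mul_self {T : Matrix (Fin m) (Fin m) ℂ} (hT : IsUnit T) :
    IsStrictlyPositive (star T * T) :=
  IsStrictlyPositive.iff_of_unital.2 ⟨star_mul_self_nonneg T, hT.star.mul hT⟩

/-- The unitary factor `T (T* T)^{-1/2}` in the polar decomposition of an invertible matrix `T`. -/
def polarFactor (T : Matrix (Fin m) (Fin m) ℂ) : Matrix (Fin m) (Fin m) ℂ :=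
  T * (star T * T) ^ (-(1 / 2) : ℝ)

theorem polarFactor_mem {T : Matrix (Fin m) (Fin m) ℂ} (hT : IsUnit T) :
    polarFactor T ∈ Matrix.unitaryGroup (Fin m) ℂ := by
  have hpos := isStrictlyPositive_star_mul_self hT
  set P := star T * T with hP
  have hsa : star (P ^ (-(1 / 2) : ℝ)) = P ^ (-(1 / 2) : ℝ) :=
    (IsSelfAdjoint.of_nonneg CFC.rpow_nonneg).star_eq
  rw [Matrix.mem_unitaryGroup_iff', polarFactor, ← hP, star_mul, hsa, mul_assoc,
    ← mul_assoc (star T), ← hP]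
  nth_rewrite 2 [← CFC.rpow_one P hpos.nonneg]
  rw [← CFC.rpow_add hpos.isUnit, ← CFC.rpow_add hpos.isUnit]
  norm_num
  exact CFC.rpow_zero P hpos.nonneg

theorem continuousOn_polarFactor :
    ContinuousOn (polarFactor (m := m)) {T | IsUnit T} := by
  refine continuousOn_id.mul ((CFC.continuousOn_rpow _).comp (t := {a | IsStrictlyPositive a})
    (Continuous.continuousOn ?_) fun T hT => isStrictlyPositive_star_mul_self hT)
  exact continuous_star.mul continuous_id

/-- If `T` intertwines two unitary matrices, so does its unitary factor. -/
theorem polarFactor_intertwines {T : Matrix (Fin m) (Fin m) ℂ} {X Y : U m}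
    (h : (X : Matrix (Fin m) (Fin m) ℂ) * T = T * Y) :
    (X : Matrix (Fin m) (Fin m) ℂ) * polarFactor T = polarFactor T * Y := by
  have hX : (X : Matrix (Fin m) (Fin m) ℂ) * star (X : Matrix (Fin m) (Fin m) ℂ) = 1 :=
    Matrix.mem_unitaryGroup_iff.1 X.2
  have hX' : star (X : Matrix (Fin m) (Fin m) ℂ) * (X : Matrix (Fin m) (Fin m) ℂ) = 1 :=
    Matrix.mem_unitaryGroup_iff'.1 X.2
  have hY : (Y : Matrix (Fin m) (Fin m) ℂ) * star (Y : Matrix (Fin m) (Fin m) ℂ) = 1 :=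
    Matrix.mem_unitaryGroup_iff.1 Y.2
  have h2 : star T * (X : Matrix (Fin m) (Fin m) ℂ) = Y * star T := by
    have h3 : star T * star (X : Matrix (Fin m) (Fin m) ℂ) =
        star (Y : Matrix (Fin m) (Fin m) ℂ) * star T := by rw [← star_mul, ← star_mul, h]
    calc star T * (X : Matrix (Fin m) (Fin m) ℂ)
        = Y * (star (Y : Matrix (Fin m) (Fin m) ℂ) * star T) * X := by
          rw [← mul_assoc, hY, one_mul]
      _ = Y * star T := by rw [← h3, mul_assoc, mul_assoc, hX', mul_one]
  have hcomm : Commute (star T * T) (Y : Matrix (Fin m) (Fin m) ℂ) := by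
    change star T * T * Y = Y * (star T * T)
    rw [mul_assoc, ← h, ← mul_assoc, h2, mul_assoc]
  have hc2 : (star T * T) ^ (-(1 / 2) : ℝ) * (Y : Matrix (Fin m) (Fin m) ℂ) =
      Y * (star T * T) ^ (-(1 / 2) : ℝ) := by
    rw [CFC.rpow_eq_cfc_real (star_mul_self_nonneg T)]
    exact hcomm.cfc_real _
  rw [polarFactor, ← mul_assoc, h, mul_assoc, ← hc2, mul_assoc]

end Polar

section LocalSection

theorem aeval_mul_of_mul_diagonal {m : ℕ} {X g : Matrix (Fin m) (Fin m) ℂ} {d : Fin m → ℂ}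
    (h : X * g = g * Matrix.diagonal d) (r : Polynomial ℂ) :
    Polynomial.aeval X r * g = g * Matrix.diagonal fun i => r.eval (d i) := by
  induction r using Polynomial.induction_on' with
  | add p q hp hq =>
    rw [map_add, add_mul, hp, hq, ← mul_add, Matrix.diagonal_add]
    simp
  | monomial k a =>
    have hk : X ^ k * g = g * Matrix.diagonal fun i => d i ^ k := by
      induction k with
      | zero => simp
      | succ k ih =>
        rw [pow_succ, mul_assoc, h, ← mul_assoc, ih, mul_assoc, Matrix.diagonal_mul_diagonal]
        simp [pow_succ]
    rw [Polynomial.aeval_monomial, mul_assoc, hk, ← mul_assoc, Algebra.commutes a g, mul_assoc,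
      Algebra.algebraMap_eq_smul_one, smul_mul_assoc, one_mul, ← Matrix.diagonal_smul]
    congr 2
    funext i
    simp

variable {s : ℕ} (mu : Fin s → ℕ) (lam : Fin s → Circle) {p : Polynomial ℂ}

/-- For `X` with spectrum in `lam`, the column of this matrix with index in the block `j` is the
projection of the corresponding column of `k` to the `lam j`-eigenspace of `X`. -/
def spectralFrame (k X : U (∑ j, mu j)) :
    Matrix (Fin (∑ j, mu j)) (Fin (∑ j, mu j)) ℂ :=
  Matrix.of fun a q =>
    (Polynomial.aeval (X : Matrix (Fin (∑ j, mu j)) (Fin (∑ j, mu j)) ℂ)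
      (Lagrange.basis Finset.univ (fun j => (lam j : ℂ)) (finSigmaFinEquiv.symm q).1) *
        (k : Matrix (Fin (∑ j, mu j)) (Fin (∑ j, mu j)) ℂ)) a q

theorem continuous_spectralFrame (k : U (∑ j, mu j)) :
    Continuous (spectralFrame mu lam k) := by
  have h : ∀ r : Polynomial ℂ, Continuous fun X : U (∑ j, mu j) =>
      Polynomial.aeval (X : Matrix (Fin (∑ j, mu j)) (Fin (∑ j, mu j)) ℂ) r := fun r => by
    simp only [Polynomial.aeval_eq_sum_range]
    fun_prop
  refine continuous_pi fun a => continuous_pi fun q => ?_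
  exact ((h _).mul continuous_const).matrix_elem a q

theorem mul_blockScalar_coe (g : U (∑ j, mu j)) :
    ((g * blockScalar mu lam : U (∑ j, mu j)) : Matrix (Fin (∑ j, mu j)) (Fin (∑ j, mu j)) ℂ) =
      (g : Matrix (Fin (∑ j, mu j)) (Fin (∑ j, mu j)) ℂ) *
        Matrix.diagonal fun q => (lam (finSigmaFinEquiv.symm q).1 : ℂ) := by
  rw [Submonoid.coe_mul, blockScalar_eq, monoU_one]

theorem mul_spectralFrame
    (hp : p = ∏ j, (Polynomial.X - Polynomial.C (lam j : ℂ)) ^ mu j)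
    (k : U (∑ j, mu j))
    (X : UP (∑ j, mu j) p) :
    (X.1 : Matrix (Fin (∑ j, mu j)) (Fin (∑ j, mu j)) ℂ) * spectralFrame mu lam k X.1 =
      spectralFrame mu lam k X.1 * (blockScalar mu lam : U (∑ j, mu j)) := by
  obtain ⟨g, hg⟩ := exists_conj_blockScalar mu lam X.1 (X.2.trans hp)
  have hXg : (X.1 : Matrix (Fin (∑ j, mu j)) (Fin (∑ j, mu j)) ℂ) *
      (g : Matrix (Fin (∑ j, mu j)) (Fin (∑ j, mu j)) ℂ) =
      (g : Matrix (Fin (∑ j, mu j)) (Fin (∑ j, mu j)) ℂ) *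
        Matrix.diagonal fun q => (lam (finSigmaFinEquiv.symm q).1 : ℂ) := by
    rw [← mul_blockScalar_coe, ← Submonoid.coe_mul]
    congr 1
    rw [hg, inv_mul_cancel_right]
  have hgg : (g : Matrix (Fin (∑ j, mu j)) (Fin (∑ j, mu j)) ℂ) * star (g : Matrix _ _ ℂ) = 1 :=
    Matrix.mem_unitaryGroup_iff.1 g.2
  -- the Lagrange basis polynomial times `z - lam j` vanishes on the spectrum of `X`
  have hzero : ∀ j, (X.1 : Matrix (Fin (∑ j, mu j)) (Fin (∑ j, mu j)) ℂ) *
      Polynomial.aeval (X.1 : Matrix (Fin (∑ j, mu j)) (Fin (∑ j, mu j)) ℂ)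
        (Lagrange.basis Finset.univ (fun j => (lam j : ℂ)) j) =
      (lam j : ℂ) • Polynomial.aeval (X.1 : Matrix (Fin (∑ j, mu j)) (Fin (∑ j, mu j)) ℂ)
        (Lagrange.basis Finset.univ (fun j => (lam j : ℂ)) j) := fun j => by
    have h1 := aeval_mul_of_mul_diagonal hXg ((Polynomial.X - Polynomial.C (lam j : ℂ)) *
      Lagrange.basis Finset.univ (fun j => (lam j : ℂ)) j)
    have h2 : (fun q => Polynomial.eval ((lam (finSigmaFinEquiv.symm q).1 : ℂ))
        ((Polynomial.X - Polynomial.C (lam j : ℂ)) *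
          Lagrange.basis Finset.univ (fun j => (lam j : ℂ)) j)) =
        (0 : Fin (∑ j, mu j) → ℂ) := by
      funext q
      rw [Polynomial.eval_mul]
      by_cases hq : (finSigmaFinEquiv.symm q).1 = j
      · rw [hq]; simp
      · rw [Lagrange.eval_basis_of_ne (v := fun j => (lam j : ℂ)) (Ne.symm hq) (Finset.mem_univ _),
          mul_zero]
        rfl
    rw [h2] at h1
    have h3 : Polynomial.aeval (X.1 : Matrix (Fin (∑ j, mu j)) (Fin (∑ j, mu j)) ℂ)
        ((Polynomial.X - Polynomial.C (lam j : ℂ)) *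
          Lagrange.basis Finset.univ (fun j => (lam j : ℂ)) j) = 0 := by
      rw [← mul_one (Polynomial.aeval _ _), ← hgg, ← mul_assoc, h1]
      simp
    rw [map_mul, map_sub, Polynomial.aeval_X, Polynomial.aeval_C, sub_mul, sub_eq_zero,
      Algebra.algebraMap_eq_smul_one, smul_mul_assoc, one_mul] at h3
    exact h3
  ext a q
  have h4 : ((X.1 : Matrix (Fin (∑ j, mu j)) (Fin (∑ j, mu j)) ℂ) *
      spectralFrame mu lam k X.1) a q = ((X.1 : Matrix (Fin (∑ j, mu j)) (Fin (∑ j, mu j)) ℂ) *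
        (Polynomial.aeval (X.1 : Matrix (Fin (∑ j, mu j)) (Fin (∑ j, mu j)) ℂ)
      (Lagrange.basis Finset.univ (fun j => (lam j : ℂ)) (finSigmaFinEquiv.symm q).1) *
        (k : Matrix (Fin (∑ j, mu j)) (Fin (∑ j, mu j)) ℂ))) a q := rfl
  rw [h4, ← mul_assoc, hzero, blockScalar_eq, monoU_one, Matrix.mul_diagonal, smul_mul_assoc,
    Matrix.smul_apply, smul_eq_mul, mul_comm]
  rfl

theorem spectralFrame_self (hlam : Function.Injective lam) (k : U (∑ j, mu j)) :
    spectralFrame mu lam k (k * blockScalar mu lam * k⁻¹) =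
      (k : Matrix (Fin (∑ j, mu j)) (Fin (∑ j, mu j)) ℂ) := by
  have hXk : ((k * blockScalar mu lam * k⁻¹ : U (∑ j, mu j)) :
      Matrix (Fin (∑ j, mu j)) (Fin (∑ j, mu j)) ℂ) *
      (k : Matrix (Fin (∑ j, mu j)) (Fin (∑ j, mu j)) ℂ) =
      (k : Matrix (Fin (∑ j, mu j)) (Fin (∑ j, mu j)) ℂ) *
        Matrix.diagonal fun q => (lam (finSigmaFinEquiv.symm q).1 : ℂ) := by
    rw [← mul_blockScalar_coe, ← Submonoid.coe_mul, inv_mul_cancel_right]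
  ext a q
  rw [spectralFrame, Matrix.of_apply, aeval_mul_of_mul_diagonal hXk, Matrix.mul_diagonal,
    Lagrange.eval_basis_self (v := fun j => (lam j : ℂ))
      (fun i _ j _ h => hlam (Circle.ext h)) (Finset.mem_univ _), mul_one]

/-- Near every point, the orbit map `U → UP` of `blockScalar` has a continuous section: the unitary
factor of the spectral frame. -/
theorem exists_local_section
    (hp : p = ∏ j, (Polynomial.X - Polynomial.C (lam j : ℂ)) ^ mu j)
    (hlam : Function.Injective lam) (X₀ : UP (∑ j, mu j) p) :
    ∃ (W : Set (UP (∑ j, mu j) p)) (h : UP (∑ j, mu j) p → U (∑ j, mu j)), IsOpen W ∧ X₀ ∈ W ∧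
      ContinuousOn h W ∧ ∀ X ∈ W, X.1 = h X * blockScalar mu lam * (h X)⁻¹ := by
  classical
  obtain ⟨k, hk⟩ := exists_conj_blockScalar mu lam X₀.1 (X₀.2.trans hp)
  let W : Set (UP (∑ j, mu j) p) := {X | IsUnit (spectralFrame mu lam k X.1)}
  have hcont : Continuous fun X : UP (∑ j, mu j) p => spectralFrame mu lam k X.1 :=
    (continuous_spectralFrame mu lam k).comp continuous_subtype_val
  refine ⟨W, fun X => if hX : X ∈ W then ⟨polarFactor (spectralFrame mu lam k X.1),
    polarFactor_mem hX⟩ else 1, ?_, ?_, ?_, fun X hX => ?_⟩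
  · have : W = {X | (spectralFrame mu lam k X.1).det ≠ 0} := by
      ext X
      exact (Matrix.isUnit_iff_isUnit_det _).trans isUnit_iff_ne_zero
    rw [this]
    exact isOpen_ne_fun (Continuous.matrix_det hcont) continuous_const
  · change IsUnit _
    rw [hk, spectralFrame_self mu lam hlam]
    exact ⟨Unitary.toUnits k, rfl⟩
  · rw [Topology.IsInducing.subtypeVal.continuousOn_iff]
    refine (continuousOn_polarFactor.comp hcont.continuousOn fun X hX => hX).congr
      fun X (hX : X ∈ W) => ?_
    simp only [Function.comp, dif_pos hX]
  · simp only [dif_pos hX]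
    rw [eq_mul_inv_iff_mul_eq]
    refine Subtype.ext ?_
    exact polarFactor_intertwines (mul_spectralFrame mu lam hp k X)

end LocalSection

/-! ### Local triviality of the restriction map -/

section FibreBundle

variable {s : ℕ} (mu : Fin s → ℕ) (lam : Fin s → Circle) {p : Polynomial ℂ}
  {Γ : Type*} [Group Γ] {x : Γ}

/-- Over the domain of a local section `h`, conjugation by `h (f x)⁻¹` makes `f x` the block scalar
matrix and so turns `f` into a block sum, which is a point of the fibre. -/
theorem isFibreBundle_res
    (hp : p = ∏ j, (Polynomial.X - Polynomial.C (lam j : ℂ)) ^ mu j)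
    (hx : ∀ γ, γ * x = x * γ) (hlam : Function.Injective lam) :
    IsFibreBundle (∀ j, HomP Γ x (mu j) ((Polynomial.X - Polynomial.C (lam j : ℂ)) ^ mu j))
      (res Γ x (∑ j, mu j) p) := by
  intro X₀
  obtain ⟨W, h, hW, hX₀, hcont, hsec⟩ := exists_local_section mu lam hp hlam X₀
  have hres : ∀ (f : HomP Γ x (∑ j, mu j) p), res Γ x _ p f ∈ W →
      ∃ φ, blockRep mu lam hp Γ x φ = (h (res Γ x _ p f))⁻¹ • f := fun f hf =>
    exists_blockRep_eq mu lam hp hx hlam _ (by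
      have h1 : f.1 x = _ := hsec _ hf
      rw [homP_smul_apply, h1]
      group)
  have hres' : ∀ X ∈ W, ∀ φ, res Γ x _ p (h X • blockRep mu lam hp Γ x φ) = X :=
    fun X hX φ => Subtype.ext (by
      change h X * (blockRep mu lam hp Γ x φ).1 x * (h X)⁻¹ = X.1
      rw [blockRep_central, ← hsec X hX])
  have hinj := blockRep_injective mu lam hp (Γ := Γ) (x := x)
  have hemb : Topology.IsClosedEmbedding (blockRep mu lam hp Γ x) :=
    (continuous_blockRep mu lam hp).isClosedEmbedding hinj
  have hopen : IsOpen (res Γ x _ p ⁻¹' W) := hW.preimage continuous_res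
  have hcinv : ContinuousOn (fun a : UP (∑ j, mu j) p ×
      (∀ j, HomP Γ x (mu j) ((Polynomial.X - Polynomial.C (lam j : ℂ)) ^ mu j)) =>
        h a.1 • blockRep mu lam hp Γ x a.2) (W ×ˢ Set.univ) :=
    (hcont.comp continuousOn_fst fun a ha => ha.1).smul
      ((continuous_blockRep mu lam hp).comp continuous_snd).continuousOn
  -- an inverse function of `blockRep` on the whole space needs a nonempty fibre
  rcases isEmpty_or_nonempty
    (∀ j, HomP Γ x (mu j) ((Polynomial.X - Polynomial.C (lam j : ℂ)) ^ mu j)) with hE | hE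
  · have hsrc : res Γ x _ p ⁻¹' W = ∅ := Set.eq_empty_of_forall_notMem fun f hf =>
      hE.elim (hres f hf).choose
    have htgt : W ×ˢ (Set.univ : Set (∀ j, HomP Γ x (mu j)
        ((Polynomial.X - Polynomial.C (lam j : ℂ)) ^ mu j))) = ∅ :=
      Set.eq_empty_of_forall_notMem fun a _ => hE.elim a.2
    have hE' : IsEmpty (HomP Γ x (∑ j, mu j) p) := ⟨fun f => by
      obtain ⟨a, -⟩ := (balancedHomeo mu lam hp hx hlam).surjective f
      induction a using Quotient.inductionOn with
      | h a => exact hE.elim a.2⟩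
    refine ⟨{
      toFun := fun f => hE'.elim f
      invFun := fun a => hE.elim a.2
      source := res Γ x _ p ⁻¹' W
      target := W ×ˢ Set.univ
      map_source' := fun f => hE'.elim f
      map_target' := fun a => hE.elim a.2
      left_inv' := fun f => hE'.elim f
      right_inv' := fun a => hE.elim a.2
      open_source := hopen
      open_target := hW.prod isOpen_univ
      continuousOn_toFun := by rw [hsrc]; exact continuousOn_empty _
      continuousOn_invFun := by rw [htgt]; exact continuousOn_empty _
      baseSet := W
      open_baseSet := hW
      source_eq := rfl
      target_eq := rfl
      proj_toFun := fun f => hE'.elim f }, hX₀⟩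
  · set ρ := Function.invFun (blockRep mu lam hp Γ x) with hρ
    have hρ1 : ∀ φ, ρ (blockRep mu lam hp Γ x φ) = φ := Function.leftInverse_invFun hinj
    have hρ2 : ∀ f, res Γ x _ p f ∈ W → blockRep mu lam hp Γ x
        (ρ ((h (res Γ x _ p f))⁻¹ • f)) = (h (res Γ x _ p f))⁻¹ • f := fun f hf =>
      Function.invFun_eq (hres f hf)
    refine ⟨{
      toFun := fun f => (res Γ x _ p f, ρ ((h (res Γ x _ p f))⁻¹ • f))
      invFun := fun a => h a.1 • blockRep mu lam hp Γ x a.2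
      source := res Γ x _ p ⁻¹' W
      target := W ×ˢ Set.univ
      map_source' := fun f hf => ⟨hf, trivial⟩
      map_target' := fun a ha => by
        rw [Set.mem_preimage, hres' _ ha.1]
        exact ha.1
      left_inv' := fun f hf => by
        change h (res Γ x _ p f) • blockRep mu lam hp Γ x (ρ ((h (res Γ x _ p f))⁻¹ • f)) = f
        rw [hρ2 f hf, smul_inv_smul]
      right_inv' := fun a ha => by
        refine Prod.ext (hres' _ ha.1 _) ?_
        simp only [hres' _ ha.1, inv_smul_smul, hρ1]
      open_source := hopen
      open_target := hW.prod isOpen_univ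
      continuousOn_toFun := by
        refine continuous_res.continuousOn.prodMk ?_
        rw [hemb.isInducing.continuousOn_iff]
        refine ContinuousOn.congr (f := fun f => (h (res Γ x _ p f))⁻¹ • f) ?_ hρ2
        exact (hcont.comp continuous_res.continuousOn fun f hf => hf).inv.smul continuousOn_id
      continuousOn_invFun := hcinv
      baseSet := W
      open_baseSet := hW
      source_eq := rfl
      target_eq := rfl
      proj_toFun := fun f _ => rfl }, hX₀⟩

theorem IsFibreBundle.congr {F F' E B : Type*} [TopologicalSpace F] [TopologicalSpace F']
    [TopologicalSpace E] [TopologicalSpace B] {f : E → B} (hf : IsFibreBundle F f)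
    (Ξ : F ≃ₜ F') : IsFibreBundle F' f := fun b => by
  obtain ⟨T, hT⟩ := hf b
  exact ⟨T.transFiberHomeomorph Ξ, hT⟩

end FibreBundle


/-! ### The finite Heisenberg datum of a root of unity -/

section FiniteHeisenberg

variable {n t : ℕ}

theorem addChar_pi_int_ext {M : Type*} [CommGroup M] {α β : AddChar (Fin n → ℤ) M}
    (h : ∀ i, α (Pi.single i 1) = β (Pi.single i 1)) : α = β :=
  DFunLike.ext _ _ fun u => pi_int_induction (p := fun u => α u = β u) (by simp)
    (fun u v hu hv => by rw [AddChar.map_add_eq_mul, AddChar.map_add_eq_mul, hu, hv])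
    (fun u hu => by rw [AddChar.map_neg_eq_inv, AddChar.map_neg_eq_inv, hu]) h u

/-- The character of `ℤⁿ` with prescribed values on the standard basis. -/
def torusChar (a : Fin n → Circle) : AddChar (Fin n → ℤ) Circle where
  toFun u := ∏ i, a i ^ u i
  map_zero_eq_one' := by simp
  map_add_eq_mul' u v := by simp [zpow_add, Finset.prod_mul_distrib]

theorem torusChar_apply (a : Fin n → Circle) (u : Fin n → ℤ) :
    torusChar a u = ∏ i, a i ^ u i := rfl

theorem torusChar_single (a : Fin n → Circle) (i : Fin n) (k : ℤ) :
    torusChar a (Pi.single i k) = a i ^ k := by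
  rw [torusChar_apply, Finset.prod_eq_single i]
  · simp
  · intro j _ hj
    rw [Pi.single_eq_of_ne hj, zpow_zero]
  · simp

theorem torusChar_eq (α : AddChar (Fin n → ℤ) Circle) :
    torusChar (fun i => α (Pi.single i 1)) = α :=
  addChar_pi_int_ext fun i => by rw [torusChar_single, zpow_one]

/-- The product of characters of the factors `ZMod (N i)`. -/
def piZModChar {N : Fin t → ℕ} (χ : ∀ i, AddChar (ZMod (N i)) Circle) :
    AddChar (∀ i, ZMod (N i)) Circle where
  toFun r := ∏ i, χ i (r i)
  map_zero_eq_one' := by simp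
  map_add_eq_mul' r s := by simp [AddChar.map_add_eq_mul, Finset.prod_mul_distrib]

theorem piZModChar_apply {N : Fin t → ℕ} (χ : ∀ i, AddChar (ZMod (N i)) Circle)
    (r : ∀ i, ZMod (N i)) : piZModChar χ r = ∏ i, χ i (r i) := rfl

theorem piZModChar_single {N : Fin t → ℕ} (χ : ∀ i, AddChar (ZMod (N i)) Circle) (i : Fin t)
    (a : ZMod (N i)) : piZModChar χ (Pi.single i a) = χ i a := by
  rw [piZModChar_apply, Finset.prod_eq_single i]
  · simp
  · intro j _ hj
    rw [Pi.single_eq_of_ne hj, AddChar.map_zero_eq_one]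
  · simp

variable (ht : 2 * t ≤ n) (N : Fin t → ℕ)

/-- Reduction of the coordinates `u_{t+i}` modulo `N i`. -/
def shiftHom : (Fin n → ℤ) →+ (∀ i, ZMod (N i)) where
  toFun u i := (u ⟨t + i, by omega⟩ : ℤ)
  map_zero' := by funext i; simp
  map_add' u v := by funext i; simp

theorem shiftHom_apply (u : Fin n → ℤ) (i : Fin t) :
    shiftHom ht N u i = ((u ⟨t + i, by omega⟩ : ℤ) : ZMod (N i)) := rfl

theorem shiftHom_surjective : Function.Surjective (shiftHom ht N) := fun r => by
  have h : ∀ i, ∃ z : ℤ, (z : ZMod (N i)) = r i := fun i => ZMod.intCast_surjective (r i)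
  choose z hz using h
  refine ⟨fun j => if h : t ≤ j.val ∧ j.val < 2 * t then z ⟨j.val - t, by omega⟩ else 0, ?_⟩
  funext i
  have h1 : t ≤ t + i.val ∧ t + i.val < 2 * t := ⟨by omega, by omega⟩
  rw [shiftHom_apply]
  simp only [dif_pos h1, add_tsub_cancel_left, Fin.eta, hz]

theorem shiftHom_single_of_ne {j : Fin n} (h : ∀ i : Fin t, j.val ≠ t + i) (k : ℤ) :
    shiftHom ht N (Pi.single j k) = 0 := by
  funext i
  have : (⟨t + i, by omega⟩ : Fin n) ≠ j := fun h1 => h i (by rw [← h1])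
  rw [shiftHom_apply, Pi.single_eq_of_ne this, Int.cast_zero, Pi.zero_apply]

theorem shiftHom_single (i : Fin t) (k : ℤ) :
    shiftHom ht N (Pi.single ⟨t + i, by omega⟩ k) = Pi.single i (k : ZMod (N i)) := by
  funext j
  by_cases hj : j = i
  · subst hj
    rw [shiftHom_apply, Pi.single_eq_same, Pi.single_eq_same]
  · have : (⟨t + j, by omega⟩ : Fin n) ≠ ⟨t + i, by omega⟩ := fun h1 => hj (Fin.ext (by
      have := Fin.mk.inj h1; omega))
    rw [shiftHom_apply, Pi.single_eq_of_ne this, Pi.single_eq_of_ne hj, Int.cast_zero]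

variable {N} (χ : ∀ i, AddChar (ZMod (N i)) Circle)

/-- The pairing `(u, r) ↦ ∏ᵢ χᵢ(rᵢ) ^ uᵢ` of `ℤⁿ` with `∏ᵢ ZMod (N i)`. -/
def phaseChar : AddChar (Fin n → ℤ) (AddChar (∀ i, ZMod (N i)) Circle) where
  toFun u := piZModChar fun i => χ i ^ u ⟨i, by omega⟩
  map_zero_eq_one' := by
    refine DFunLike.ext _ _ fun r => ?_
    simp [piZModChar_apply]
  map_add_eq_mul' u v := by
    refine DFunLike.ext _ _ fun r => ?_
    simp only [piZModChar_apply, AddChar.mul_apply, Pi.add_apply, zpow_add,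
      Finset.prod_mul_distrib]

theorem phaseChar_apply (u : Fin n → ℤ) (r : ∀ i, ZMod (N i)) :
    phaseChar ht χ u r = ∏ i : Fin t, χ i (r i) ^ u ⟨i, by omega⟩ := by
  have h : ∀ (i : Fin t) (k : ℤ), (χ i ^ k) (r i) = χ i (r i) ^ k := fun i k =>
    map_zpow (⟨⟨fun χ : AddChar (ZMod (N i)) Circle => χ (r i), rfl⟩, fun _ _ => rfl⟩ :
      AddChar (ZMod (N i)) Circle →* Circle) (χ i) k
  change ∏ i : Fin t, (χ i ^ u ⟨i, by omega⟩) (r i) = _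
  simp only [h]

theorem phaseChar_single_of_le {j : Fin n} (h : t ≤ j.val) (k : ℤ) :
    phaseChar ht χ (Pi.single j k) = 1 := by
  refine DFunLike.ext _ _ fun r => ?_
  rw [phaseChar_apply, AddChar.one_apply]
  refine Finset.prod_eq_one fun i _ => ?_
  have : (⟨i, by omega⟩ : Fin n) ≠ j := fun h1 => by
    rw [← h1] at h
    have := i.2
    simp only at h
    omega
  rw [Pi.single_eq_of_ne this, zpow_zero]

theorem phaseChar_single (i : Fin t) (k : ℤ) (r : ∀ i, ZMod (N i)) :
    phaseChar ht χ (Pi.single ⟨i, by omega⟩ k) r = χ i (r i) ^ k := by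
  rw [phaseChar_apply, Finset.prod_eq_single i]
  · rw [Pi.single_eq_same]
  · intro j _ hj
    have : (⟨j, by omega⟩ : Fin n) ≠ ⟨i, by omega⟩ := fun h1 => hj (Fin.ext (Fin.mk.inj h1))
    rw [Pi.single_eq_of_ne this, zpow_zero]
  · simp

theorem phaseChar_shiftHom (c : Fin t → ℕ) (z : Circle) (hz : ∀ i, χ i 1 = z ^ c i)
    (u v : Fin n → ℤ) : phaseChar ht χ u (shiftHom ht N v) = z ^ wform ht c u v := by
  have h : ∀ (i : Fin t) (k : ℤ), χ i (k : ZMod (N i)) = z ^ (c i * k) := fun i k => by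
    rw [← zsmul_one, AddChar.map_zsmul_eq_zpow, hz, zpow_mul, zpow_natCast]
  rw [phaseChar_apply, wform]
  have h2 : ∀ (ι : Finset (Fin t)) (f : Fin t → ℤ), z ^ (∑ i ∈ ι, f i) = ∏ i ∈ ι, z ^ f i :=
    fun ι f => by
      induction ι using Finset.cons_induction with
      | empty => simp
      | cons a ι ha ih => rw [Finset.sum_cons, Finset.prod_cons, zpow_add, ih]
  rw [h2]
  refine Finset.prod_congr rfl fun i _ => ?_
  rw [shiftHom_apply, h, ← zpow_mul]
  congr 1
  ring

theorem phaseChar_separating (hχ : ∀ i, Function.Injective (χ i)) (r r' : ∀ i, ZMod (N i))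
    (h : ∀ u, shiftHom ht N u = 0 → phaseChar ht χ u r = phaseChar ht χ u r') : r = r' := by
  funext i
  have h1 := h (Pi.single ⟨i, by omega⟩ 1)
    (shiftHom_single_of_ne ht N (fun k => by simp only; omega) 1)
  rw [phaseChar_single, phaseChar_single, zpow_one, zpow_one] at h1
  exact hχ i h1

variable (N) in
/-- The index of the sublattice `{u | sh u = 0, ψ u = 1}` of `ℤⁿ` in the direction of the `i`-th
coordinate. -/
def torusExp (i : Fin n) : ℕ :=
  if h : i.val < t then N ⟨i, h⟩ else if h : i.val < 2 * t then N ⟨i.val - t, by omega⟩ else 1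

variable (N) in
theorem torusExp_left (i : Fin t) : torusExp N (⟨i, by omega⟩ : Fin n) = N i := by
  rw [torusExp, dif_pos i.2]

variable (N) in
theorem torusExp_right (i : Fin t) : torusExp N (⟨t + i, by omega⟩ : Fin n) = N i := by
  have h1 : ¬ t + i.val < t := by omega
  have h2 : t + i.val < 2 * t := by omega
  simp only [torusExp, dif_neg h1, dif_pos h2, add_tsub_cancel_left]

theorem torusExp_pos [∀ i, NeZero (N i)] (i : Fin n) : 0 < torusExp N i := by
  rw [torusExp]
  split_ifs
  · exact NeZero.pos _
  · exact NeZero.pos _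
  · exact one_pos

/-- The coordinates of `ℤⁿ` are of three kinds. -/
theorem coord_cases {P : Fin n → Prop} (h1 : ∀ i : Fin t, P ⟨i, by omega⟩)
    (h2 : ∀ i : Fin t, P ⟨t + i, by omega⟩) (h3 : ∀ j : Fin n, 2 * t ≤ j.val → P j) (j : Fin n) :
    P j := by
  rcases lt_or_ge j.val t with h | h
  · exact h1 ⟨j, h⟩
  · rcases lt_or_ge j.val (2 * t) with h' | h'
    · have := h2 ⟨j.val - t, by omega⟩
      have e : (⟨t + (j.val - t), by omega⟩ : Fin n) = j := Fin.ext (by simp; omega)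
      simpa only [e] using this
    · exact h3 j h'

theorem shiftHom_single_torusExp (j : Fin n) :
    shiftHom ht N (Pi.single j (torusExp N j : ℤ)) = 0 := by
  refine coord_cases ht (P := fun j => shiftHom ht N (Pi.single j (torusExp N j : ℤ)) = 0)
    (fun i => ?_) (fun i => ?_) (fun j hj => ?_) j
  · exact shiftHom_single_of_ne ht N (fun k => by simp only; omega) _
  · rw [shiftHom_single, torusExp_right ht]
    simp
  · exact shiftHom_single_of_ne ht N (fun k => by omega) _

theorem phaseChar_single_torusExp (j : Fin n) :
    phaseChar ht χ (Pi.single j (torusExp N j : ℤ)) = 1 := by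
  refine coord_cases ht (P := fun j => phaseChar ht χ (Pi.single j (torusExp N j : ℤ)) = 1)
    (fun i => ?_) (fun i => ?_) (fun j hj => ?_) j
  · refine DFunLike.ext _ _ fun r => ?_
    rw [phaseChar_single, torusExp_left ht, ← AddChar.map_zsmul_eq_zpow]
    simp
  · exact phaseChar_single_of_le ht χ (by simp) _
  · exact phaseChar_single_of_le ht χ (by omega) _

/-- A point of the torus which becomes trivial after raising the coordinates to the powers
`torusExp` is the product of a phase and a character of the shift. -/
theorem exists_phase_of_pow_eq_one [∀ i, NeZero (N i)]
    (hχ : ∀ i (w : Circle), w ^ N i = 1 → ∃ r, χ i r = w) (ω : Fin n → Circle)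
    (hω : ∀ i, ω i ^ torusExp N i = 1) :
    ∃ (r : ∀ i, ZMod (N i)) (κ : AddChar (∀ i, ZMod (N i)) Circle), ∀ u,
      torusChar ω u * κ (shiftHom ht N u) = phaseChar ht χ u r := by
  have h1 : ∀ i : Fin t, ∃ r, χ i r = ω ⟨i, by omega⟩ := fun i => hχ i _ (by
    have := hω ⟨i, by omega⟩
    rwa [torusExp_left ht] at this)
  choose r hr using h1
  have h2 : ∀ i : Fin t, (ω ⟨t + i, by omega⟩)⁻¹ ^ N i = 1 := fun i => by
    have := hω ⟨t + i, by omega⟩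
    rw [torusExp_right ht] at this
    rw [inv_pow, this, inv_one]
  refine ⟨r, piZModChar fun i => AddChar.zmodChar (N i) (h2 i), fun u => ?_⟩
  set κ := piZModChar fun i => AddChar.zmodChar (N i) (h2 i) with hκ
  let A : AddChar (Fin n → ℤ) Circle := torusChar ω * κ.compAddMonoidHom (shiftHom ht N)
  let B : AddChar (Fin n → ℤ) Circle :=
    { toFun := fun u => phaseChar ht χ u r
      map_zero_eq_one' := by simp
      map_add_eq_mul' := fun u v => by rw [AddChar.map_add_eq_mul, AddChar.mul_apply] }
  have hAB : A = B := addChar_pi_int_ext fun j => by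
    refine coord_cases ht (P := fun j => torusChar ω (Pi.single j 1) *
      κ (shiftHom ht N (Pi.single j 1)) = phaseChar ht χ (Pi.single j 1) r)
      (fun i => ?_) (fun i => ?_) (fun j hj => ?_) j
    · rw [shiftHom_single_of_ne ht N (fun k => by simp only; omega), phaseChar_single, hr,
        torusChar_single, AddChar.map_zero_eq_one, mul_one]
    · rw [shiftHom_single, phaseChar_single_of_le ht χ (by simp), torusChar_single,
        hκ, piZModChar_single, zpow_one, AddChar.one_apply]
      have h3 := AddChar.zmodChar_apply' (h2 i) 1
      rw [Nat.cast_one, pow_one] at h3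
      rw [Int.cast_one, h3, mul_inv_cancel]
    · have h3 := hω j
      rw [torusExp, dif_neg (by omega), dif_neg (by omega), pow_one] at h3
      rw [shiftHom_single_of_ne ht N (fun k => by omega), phaseChar_single_of_le ht χ (by omega),
        torusChar_single, h3, AddChar.map_zero_eq_one, AddChar.one_apply, one_zpow, mul_one]
  exact DFunLike.congr_fun hAB u

theorem zmodChar_injective {N : ℕ} [NeZero N] {ζ : Circle} (hζ : IsPrimitiveRoot ζ N) :
    Function.Injective (AddChar.zmodChar N hζ.pow_eq_one) := fun a b h => by
  rw [AddChar.zmodChar_apply, AddChar.zmodChar_apply] at h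
  exact ZMod.val_injective N (hζ.pow_inj (ZMod.val_lt a) (ZMod.val_lt b) h)

theorem exists_zmodChar_eq {N : ℕ} [NeZero N] {ζ : Circle} (hζ : IsPrimitiveRoot ζ N) {w : Circle}
    (hw : w ^ N = 1) : ∃ r, AddChar.zmodChar N hζ.pow_eq_one r = w := by
  have h1 : IsPrimitiveRoot (ζ : ℂ) N :=
    hζ.map_of_injective (f := Circle.coeHom) Circle.coe_injective
  obtain ⟨i, -, hi⟩ := h1.eq_pow_of_pow_eq_one (ξ := (w : ℂ)) (by
    rw [← Circle.coe_pow, hw, Circle.coe_one])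
  refine ⟨(i : ZMod N), ?_⟩
  rw [AddChar.zmodChar_apply']
  exact Circle.ext (by rw [Circle.coe_pow, hi])

end FiniteHeisenberg


/-! ### Representations with central element a root of unity -/

section Standard

theorem continuous_monoU {ι : Type*} [Fintype ι] [DecidableEq ι] (σ : Equiv.Perm ι) :
    Continuous (monoU σ) := by
  refine Continuous.subtype_mk (continuous_pi fun p => continuous_pi fun q => ?_) _
  simp only [Matrix.of_apply]
  split_ifs
  · exact continuous_subtype_val.comp (continuous_apply q)
  · exact continuous_const

variable {n t : ℕ} {ht : 2 * t ≤ n} {c : Fin t → ℕ} {Γ : Type*} [Group Γ] {x : Γ}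
  {s : (Fin n → ℤ) → Γ} {N : Fin t → ℕ} {l m : ℕ}

theorem IsNormalForm.exists_stdHom (hs : IsNormalForm x ht c s)
    (χ : ∀ i, AddChar (ZMod (N i)) Circle) {z : Circle} (hz : ∀ i, χ i 1 = z ^ c i)
    (eq : Fin l × (∀ i, ZMod (N i)) ≃ Fin m) (a : Fin l → Fin n → Circle) :
    ∃ f : HomP Γ x m ((Polynomial.X - Polynomial.C (z : ℂ)) ^ m), f.1 x = scalarU z ∧
      ∀ u, f.1 (s u) =
        stdU (shiftHom ht N) (phaseChar ht χ) eq (fun k => torusChar (a k)) u := by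
  obtain ⟨f, hf, hfu⟩ := hs.exists_hom (scalarU z : U m)
    (stdU (shiftHom ht N) (phaseChar ht χ) eq fun k => torusChar (a k))
    (fun h => (scalarU_comm z h).symm) (fun u v => by
      rw [stdU_mul, phaseChar_shiftHom ht χ c z hz, scalarU_zpow])
  exact ⟨⟨f, by rw [hf, charpoly_scalarU]⟩, hf, hfu⟩

/-- The representation of `Γ` on `ℂᵐ` with parameter `a` in `l` copies of the torus: a sum of `l`
irreducible representations of dimension `∏ᵢ N i`, the `k`-th one twisted by the character of
`ℤⁿ` corresponding to `a k`. -/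
def stdHom (hs : IsNormalForm x ht c s) (χ : ∀ i, AddChar (ZMod (N i)) Circle) {z : Circle}
    (hz : ∀ i, χ i 1 = z ^ c i) (eq : Fin l × (∀ i, ZMod (N i)) ≃ Fin m)
    (a : Fin l → Fin n → Circle) :
    HomP Γ x m ((Polynomial.X - Polynomial.C (z : ℂ)) ^ m) :=
  (hs.exists_stdHom χ hz eq a).choose

variable (hs : IsNormalForm x ht c s) (χ : ∀ i, AddChar (ZMod (N i)) Circle) {z : Circle}
    (hz : ∀ i, χ i 1 = z ^ c i) (eq : Fin l × (∀ i, ZMod (N i)) ≃ Fin m)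

theorem stdHom_central (a : Fin l → Fin n → Circle) :
    (stdHom hs χ hz eq a).1 x = scalarU z := (hs.exists_stdHom χ hz eq a).choose_spec.1

theorem stdHom_apply (a : Fin l → Fin n → Circle) (u : Fin n → ℤ) :
    (stdHom hs χ hz eq a).1 (s u) =
      stdU (shiftHom ht N) (phaseChar ht χ) eq (fun k => torusChar (a k)) u :=
  (hs.exists_stdHom χ hz eq a).choose_spec.2 u

theorem continuous_stdHom : Continuous (stdHom hs χ hz eq) := by
  refine continuous_homP_iff.2 fun γ => ?_
  obtain ⟨k, u, rfl⟩ := hs.exists_eq γ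
  simp only [map_mul, map_zpow, stdHom_central, stdHom_apply, stdU, torusChar_apply]
  refine continuous_const.mul ((continuous_monoU _).comp (continuous_pi fun p => ?_))
  refine Continuous.mul (continuous_finsetProd _ fun i _ => ?_) continuous_const
  exact ((continuous_apply i).comp (continuous_apply _)).zpow _

theorem smul_stdHom_eq_iff {f : HomP Γ x m ((Polynomial.X - Polynomial.C (z : ℂ)) ^ m)} {g : U m}
    {a : Fin l → Fin n → Circle} : f = g • stdHom hs χ hz eq a ↔
      ∀ u, f.1 (s u) = g *
        stdU (shiftHom ht N) (phaseChar ht χ) eq (fun k => torusChar (a k)) u * g⁻¹ := by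
  refine ⟨fun h u => ?_, fun h => Subtype.ext (hs.hom_ext' ?_ fun u => ?_)⟩
  · rw [h, homP_smul_apply, stdHom_apply]
  · rw [homP_smul_apply, stdHom_central, homP_map_central, ← scalarU_comm, mul_inv_cancel_right]
  · rw [h, homP_smul_apply, stdHom_apply]

variable [∀ i, NeZero (N i)]

/-- Every representation is conjugate to a standard one. -/
theorem exists_smul_stdHom (hχ : ∀ i, Function.Injective (χ i))
    (f : HomP Γ x m ((Polynomial.X - Polynomial.C (z : ℂ)) ^ m)) :
    (∏ i, N i) ∣ m ∧ ∀ (l : ℕ) (eq : Fin l × (∀ i, ZMod (N i)) ≃ Fin m),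
      ∃ (a : Fin l → Fin n → Circle) (g : U m), f = g • stdHom hs χ hz eq a := by
  obtain ⟨h1, h2⟩ := exists_conj_stdU (shiftHom ht N) (phaseChar ht χ) (fun u => f.1 (s u))
    (by simp only [hs.map_zero, map_one]) (fun u v => by
      rw [hs.map_mul_map, homP_map_central, phaseChar_shiftHom ht χ c z hz, scalarU_zpow])
    (shiftHom_surjective ht N) (phaseChar_separating ht χ hχ)
  rw [Fintype.card_pi] at h1
  simp only [ZMod.card] at h1
  refine ⟨h1, fun l eq => ?_⟩
  obtain ⟨α, g, hg⟩ := h2 l eq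
  refine ⟨fun k i => α k (Pi.single i 1), g, (smul_stdHom_eq_iff hs χ hz eq).2 fun u => ?_⟩
  simp only [hg, torusChar_eq]

/-- Two standard representations are conjugate exactly if their parameters agree up to a
permutation after raising the coordinates to the powers `torusExp`: these powers are the
eigenvalues of the elements `s u` that act diagonally. -/
theorem stdHom_conj_iff (hχ : ∀ i (w : Circle), w ^ N i = 1 → ∃ r, χ i r = w)
    (a a' : Fin l → Fin n → Circle) :
    (∃ g : U m, stdHom hs χ hz eq a = g • stdHom hs χ hz eq a') ↔
      ∃ τ : Equiv.Perm (Fin l), ∀ k i, a' k i ^ torusExp N i = a (τ k) i ^ torusExp N i := by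
  simp only [smul_stdHom_eq_iff hs χ hz eq, stdHom_apply]
  constructor
  · rintro ⟨g, hg⟩
    obtain ⟨σ, hσ⟩ := exists_perm_of_conj_diagonal g
      (fun i p => a' (eq.symm p).1 i ^ torusExp N i)
      (fun i p => a (eq.symm p).1 i ^ torusExp N i) (fun i => by
        have h1 := hg (Pi.single i (torusExp N i))
        rw [stdU_eq_diagonal _ _ _ (shiftHom_single_torusExp ht i)
          (phaseChar_single_torusExp ht χ i), stdU_eq_diagonal _ _ _
          (shiftHom_single_torusExp ht i) (phaseChar_single_torusExp ht χ i),
          eq_mul_inv_iff_mul_eq] at h1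
        simpa only [torusChar_single, zpow_natCast] using h1.symm)
    classical
    have hcard : ∀ (f : Fin l → Fin n → Circle) (b : Fin n → Circle),
        Fintype.card {p // f (eq.symm p).1 = b} =
          Fintype.card {k // f k = b} * Fintype.card (∀ i, ZMod (N i)) := fun f b => by
      rw [← Fintype.card_prod]
      exact Fintype.card_congr
        ((eq.symm.subtypeEquiv (q := fun q => f q.1 = b) fun p => Iff.rfl).trans
          (Equiv.prodSubtypeFstEquivSubtypeProd (p := fun k => f k = b)))
    -- each value is taken `∏ᵢ N i` times as often on `Fin m` as on `Fin l`
    obtain ⟨τ, hτ⟩ := exists_equiv_of_card_fiber (fun k i => a' k i ^ torusExp N i)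
      (fun k i => a k i ^ torusExp N i) fun b => by
        refine Nat.eq_of_mul_eq_mul_right
          (Fintype.card_pos (α := ∀ i, ZMod (N i))) ?_
        rw [← hcard, ← hcard]
        refine Fintype.card_congr (σ.subtypeEquiv fun p => ?_)
        rw [show (fun i => a' (eq.symm p).1 i ^ torusExp N i) =
          fun i => a (eq.symm (σ p)).1 i ^ torusExp N i from funext fun i => hσ i p]
    exact ⟨τ, fun k i => (congrFun (hτ k) i).symm⟩
  · rintro ⟨τ, hτ⟩
    have h1 := fun k => exists_phase_of_pow_eq_one ht χ hχ (fun i => a' k i / a (τ k) i)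
      fun i => by rw [div_pow, hτ, div_self']
    choose r κ h1 using h1
    refine stdU_conj _ _ eq τ r κ fun k u => ?_
    rw [← h1 k u, ← mul_assoc]
    congr 1
    simp only [torusChar_apply, ← Finset.prod_mul_distrib, ← mul_zpow, mul_div_cancel]

end Standard

/-! ### Orbit spaces -/

section OrbitSpace

theorem isOpenQuotientMap_circle_pow {N : ℕ} (hN : 0 < N) :
    IsOpenQuotientMap fun w : Circle => w ^ N := by
  have hsurj : Function.Surjective fun w : Circle => w ^ N := fun w =>
    ⟨Circle.exp (Complex.arg (w : ℂ) / N), by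
      change _ ^ N = w
      rw [← Circle.exp_nsmul, nsmul_eq_mul, mul_div_cancel₀ _ (by positivity), Circle.exp_arg]⟩
  have hcont : Continuous fun w : Circle => w ^ N := continuous_pow N
  exact MonoidHom.isOpenQuotientMap_of_isQuotientMap (φ := powMonoidHom (α := Circle) N)
    (hcont.isClosedMap.isQuotientMap hcont hsurj)

theorem isOpenQuotientMap_symProd (l : ℕ) (X : Type*) [TopologicalSpace X] :
    IsOpenQuotientMap (Quotient.mk (symSetoid l X) : (Fin l → X) → SymProd l X) := by
  refine ⟨Quotient.mk_surjective, continuous_quotient_mk', fun V hV => ?_⟩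
  refine isQuotientMap_quotient_mk'.isOpen_preimage.1 ?_
  change IsOpen (Quotient.mk (symSetoid l X) ⁻¹' _)
  have : Quotient.mk (symSetoid l X) ⁻¹' (Quotient.mk (symSetoid l X) '' V) =
      ⋃ τ : Equiv.Perm (Fin l), (fun a => a ∘ τ) ⁻¹' V := by
    ext a
    simp only [Set.mem_preimage, Set.mem_image, Set.mem_iUnion]
    constructor
    · rintro ⟨b, hb, h⟩
      obtain ⟨τ, rfl⟩ := Quotient.exact h.symm
      exact ⟨τ, hb⟩
    · rintro ⟨τ, hτ⟩
      exact ⟨_, hτ, (Quotient.sound ⟨τ, rfl⟩ : Quotient.mk (symSetoid l X) a = _).symm⟩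
  refine this ▸ isOpen_iUnion fun τ => hV.preimage (continuous_pi fun i => continuous_apply (τ i))

/-- Quotient maps with the same fibres have homeomorphic targets. -/
theorem nonempty_homeomorph_of_isQuotientMap {A X Y : Type*} [TopologicalSpace A]
    [TopologicalSpace X] [TopologicalSpace Y] {f : A → X} {g : A → Y}
    (hf : Topology.IsQuotientMap f) (hg : Topology.IsQuotientMap g)
    (h : ∀ a b, f a = f b ↔ g a = g b) : Nonempty (X ≃ₜ Y) := by
  have h1 : Setoid.ker f = Setoid.ker g := Setoid.ext h
  let ef := hf.homeomorph (f := ⟨f, hf.continuous⟩)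
  let eg := hg.homeomorph (f := ⟨g, hg.continuous⟩)
  have e : Quotient (Setoid.ker f) ≃ₜ Quotient (Setoid.ker g) := h1 ▸ Homeomorph.refl _
  exact ⟨(ef.symm.trans e).trans eg⟩

instance t2Space_quotient_homP (Γ : Type*) [Group Γ] (x : Γ) (m : ℕ) (p : Polynomial ℂ) :
    T2Space (Quotient (MulAction.orbitRel (U m) (HomP Γ x m p))) :=
  haveI : ProperSMul (U m) (HomP Γ x m p) :=
    ⟨(continuous_smul.prodMk continuous_snd).isProperMap⟩
  t2Space_quotient_mulAction_of_properSMul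

variable {n t : ℕ} {ht : 2 * t ≤ n} {c : Fin t → ℕ} {Γ : Type*} [Group Γ] {x : Γ}
  {s : (Fin n → ℤ) → Γ} {b : ℕ} (mu : Fin b → ℕ) (lam : Fin b → Circle) {p : Polynomial ℂ}

/-- The orbit space is a product of symmetric products of tori: it is a quotient of the parameter
space of the standard representations, with the same fibres as the map which raises the parameters
to the powers `torusExp` and forgets their order. -/
theorem orbitSpace_homeomorph
    (hp : p = ∏ j, (Polynomial.X - Polynomial.C (lam j : ℂ)) ^ mu j)
    (hs : IsNormalForm x ht c s) (hlam : Function.Injective lam)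
    (k : Fin b → ℕ) (hk : ∀ j, 0 < k j) (hprim : ∀ j, IsPrimitiveRoot (lam j) (k j))
    (hne : Nonempty (HomP Γ x (∑ j, mu j) p)) :
    (∀ j, (∏ i, k j / Nat.gcd (k j) (c i)) ∣ mu j) ∧
      Nonempty (Quotient (MulAction.orbitRel (U (∑ j, mu j)) (HomP Γ x (∑ j, mu j) p)) ≃ₜ
        ∀ j, SymProd (mu j / ∏ i, k j / Nat.gcd (k j) (c i)) (Fin n → Circle)) := by
  set N : Fin b → Fin t → ℕ := fun j i => k j / Nat.gcd (k j) (c i) with hN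
  have hN0 : ∀ j i, NeZero (N j i) := fun j i =>
    ⟨(Nat.div_pos (Nat.gcd_le_left _ (hk j)) (Nat.gcd_pos_of_pos_left _ (hk j))).ne'⟩
  have hζ : ∀ j i, IsPrimitiveRoot (lam j ^ c i) (N j i) := fun j i => by
    have h1 : orderOf (lam j ^ c i) = N j i := by
      rw [IsOfFinOrder.orderOf_pow _ _ ((hprim j).isOfFinOrder (hk j).ne'), ← (hprim j).eq_orderOf]
    exact h1 ▸ IsPrimitiveRoot.orderOf _
  let χ : ∀ j i, AddChar (ZMod (N j i)) Circle := fun j i =>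
    AddChar.zmodChar (N j i) (hζ j i).pow_eq_one
  have hz : ∀ j i, χ j i 1 = lam j ^ c i := fun j i => by
    have h1 := AddChar.zmodChar_apply' (hζ j i).pow_eq_one 1
    rwa [Nat.cast_one, pow_one] at h1
  have hinj : ∀ j i, Function.Injective (χ j i) := fun j i => zmodChar_injective (hζ j i)
  have hroot : ∀ j i (w : Circle), w ^ N j i = 1 → ∃ r, χ j i r = w := fun j i w hw =>
    exists_zmodChar_eq (hζ j i) hw
  -- every representation is conjugate to a block sum
  have hblock : ∀ f : HomP Γ x (∑ j, mu j) p, ∃ g φ, f = g • blockRep mu lam hp Γ x φ :=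
    fun f => by
      obtain ⟨q, hq⟩ := (balancedHomeo mu lam hp hs.central hlam).surjective f
      induction q using Quotient.inductionOn with
      | h q => exact ⟨q.1, q.2, hq.symm⟩
  have hdiv : ∀ j, (∏ i, N j i) ∣ mu j := fun j => by
    obtain ⟨f⟩ := hne
    obtain ⟨g, φ, -⟩ := hblock f
    exact (exists_smul_stdHom hs (χ j) (hz j) (hinj j) (φ j)).1
  refine ⟨hdiv, ?_⟩
  have heq : ∀ j, Nonempty (Fin (mu j / ∏ i, N j i) × (∀ i, ZMod (N j i)) ≃ Fin (mu j)) :=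
    fun j => ⟨Fintype.equivOfCardEq (by
      simp only [Fintype.card_prod, Fintype.card_fin, Fintype.card_pi, ZMod.card]
      exact Nat.div_mul_cancel (hdiv j))⟩
  let eq := fun j => (heq j).some
  let A := ∀ j, Fin (mu j / ∏ i, N j i) → Fin n → Circle
  let φ : A → ∀ j, HomP Γ x (mu j) ((Polynomial.X - Polynomial.C (lam j : ℂ)) ^ mu j) :=
    fun a j => stdHom hs (χ j) (hz j) (eq j) (a j)
  let Q : A → Quotient (MulAction.orbitRel (U (∑ j, mu j)) (HomP Γ x (∑ j, mu j) p)) :=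
    fun a => Quotient.mk _ (blockRep mu lam hp Γ x (φ a))
  have hQc : Continuous Q := continuous_quotient_mk'.comp ((continuous_blockRep mu lam hp).comp
    (continuous_pi fun j => (continuous_stdHom hs (χ j) (hz j) (eq j)).comp (continuous_apply j)))
  have hQs : Function.Surjective Q := fun q => by
    induction q using Quotient.inductionOn with
    | h f =>
      obtain ⟨g, ψ, rfl⟩ := hblock f
      have h1 := fun j => (exists_smul_stdHom hs (χ j) (hz j) (hinj j) (ψ j)).2 _ (eq j)
      choose a h h1 using h1
      refine ⟨a, Quotient.sound ?_⟩
      have h2 : ψ = h • φ a := funext h1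
      refine ⟨(g * blockEmb mu h)⁻¹, ?_⟩
      simp only
      rw [h2, blockRep_smul, smul_smul g, inv_smul_smul]
  let P : A → ∀ j, SymProd (mu j / ∏ i, N j i) (Fin n → Circle) :=
    Pi.map fun j => Quotient.mk (symSetoid _ _) ∘
      Pi.map fun _ => Pi.map fun i w => w ^ torusExp (N j) i
  have hP : IsOpenQuotientMap P := IsOpenQuotientMap.piMap fun j =>
    (isOpenQuotientMap_symProd _ _).comp (IsOpenQuotientMap.piMap fun _ =>
      IsOpenQuotientMap.piMap fun i => isOpenQuotientMap_circle_pow (torusExp_pos i))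
  refine nonempty_homeomorph_of_isQuotientMap (hQc.isClosedMap.isQuotientMap hQc hQs)
    hP.isQuotientMap fun a a' => ?_
  have hker : ∀ j, (∃ g : U (mu j), φ a j = g • φ a' j) ↔ P a j = P a' j := fun j => by
    refine (stdHom_conj_iff hs (χ j) (hz j) (eq j) (hroot j) (a j) (a' j)).trans ?_
    refine Iff.trans ?_ Quotient.eq.symm
    exact exists_congr fun τ => ⟨fun h => funext fun k => funext fun i => h k i,
      fun h k i => congrFun (congrFun h k) i⟩
  -- block sums are conjugate exactly if their blocks are
  rw [funext_iff (f := P a)]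
  simp only [← hker]
  constructor
  · intro h
    obtain ⟨g, hg⟩ := Quotient.exact h
    have hg' : g • blockRep mu lam hp Γ x (φ a') =
        (1 : U (∑ j, mu j)) • blockRep mu lam hp Γ x (φ a) :=
      hg.trans (one_smul _ _).symm
    obtain ⟨h, -, hh⟩ := (smul_blockRep_eq_iff mu lam hp hlam _ _ _ _).1 hg'
    exact fun j => ⟨h j, congrFun hh j⟩
  · intro h
    choose h hh using h
    refine Quotient.sound ⟨blockEmb mu h, ?_⟩
    simp only
    rw [← blockRep_smul, show φ a = h • φ a' from funext hh]

end OrbitSpace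

end RankOne

end

theorem theoremB {n t s : ℕ} (ht : 2 * t ≤ n) (c : Fin t → ℕ) (hc : ∀ i, 0 < c i)
    (hdvd : ∀ (i : ℕ) (hi : i + 1 < t), c ⟨i, by omega⟩ ∣ c ⟨i + 1, hi⟩)
    (e : Module.Basis (Fin n) ℤ (Fin n → ℤ))
    {Γ : Type*} [Group Γ]
    (S : GroupExtension (Multiplicative ℤ) Γ (Multiplicative (Fin n → ℤ)))
    (hS : IsCentral S) (hω : kInvariant S hS = wedgeClass e ht c)
    (lam : Fin s → Circle) (hlam : Function.Injective lam)
    (mu : Fin s → ℕ) (hmu : ∀ j, 0 < mu j)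
    (x : Γ) (hx : x = S.inl (Multiplicative.ofAdd 1))
    (p : Polynomial ℂ)
    (hp : p = ∏ j, (Polynomial.X - Polynomial.C (lam j : ℂ)) ^ mu j)
    (D : Fin s → Matrix (Fin n) (Fin n) UnitAddCircle)
    (hD : ∀ j, D j = Dmat n fun i => -((c i : ℤ) • logQ (lam j))) :
    (∃ (Θ : UP (∑ j, mu j) p ≃ₜ U (∑ j, mu j) ⧸ (blockEmb mu).range)
      (Φ : HomP Γ x (∑ j, mu j) p ≃ₜ
        BalancedProduct (blockEmb mu) (∀ j, HomP Γ x (mu j)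
          ((Polynomial.X - Polynomial.C (lam j : ℂ)) ^ mu j)))
      (Ψ : HomP Γ x (∑ j, mu j) p ≃ₜ
        BalancedProduct (blockEmb mu) (∀ j, BD (mu j) (D j))),
      (∀ (g : U (∑ j, mu j)) (X : UP (∑ j, mu j) p), Θ (g • X) = g • Θ X) ∧
      (∀ (g : U (∑ j, mu j)) (f : HomP Γ x (∑ j, mu j) p), Φ (g • f) = g • Φ f) ∧
      (∀ (g : U (∑ j, mu j)) (f : HomP Γ x (∑ j, mu j) p), Ψ (g • f) = g • Ψ f) ∧
      (∀ f : HomP Γ x (∑ j, mu j) p, Θ (res Γ x _ p f) = collapse _ _ (Φ f)) ∧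
      (∀ f : HomP Γ x (∑ j, mu j) p, Θ (res Γ x _ p f) = collapse _ _ (Ψ f))) ∧
    IsFibreBundle (∀ j, HomP Γ x (mu j) ((Polynomial.X - Polynomial.C (lam j : ℂ)) ^ mu j))
      (res Γ x (∑ j, mu j) p) ∧
    IsFibreBundle (∀ j, BD (mu j) (D j)) (res Γ x (∑ j, mu j) p) ∧
    (∀ k : Fin s → ℕ, (∀ j, 0 < k j) → (∀ j, IsPrimitiveRoot (lam j) (k j)) →
      Nonempty (HomP Γ x (∑ j, mu j) p) →
      (∀ j, (∏ i, k j / Nat.gcd (k j) (c i)) ∣ mu j) ∧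
      Nonempty (Quotient (MulAction.orbitRel (U (∑ j, mu j)) (HomP Γ x (∑ j, mu j) p)) ≃ₜ
        ∀ j, SymProd (mu j / ∏ i, k j / Nat.gcd (k j) (c i)) (Fin n → Circle))) := by
  obtain ⟨σ, hs⟩ := exists_isNormalForm ht c e S hS hω
  rw [← hx] at hs
  obtain rfl : D = fun j => Dmat n fun i => -((c i : ℤ) • logQ (lam j)) := funext hD
  let Ξ : (∀ j, HomP Γ x (mu j) ((Polynomial.X - Polynomial.C (lam j : ℂ)) ^ mu j)) ≃ₜ
      ∀ j, BD (mu j) (Dmat n fun i => -((c i : ℤ) • logQ (lam j))) :=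
    Homeomorph.piCongrRight fun j => hs.homeoBD (mu j) (lam j)
  have hΞ : ∀ (h : ∀ j, U (mu j)) φ, Ξ (h • φ) = h • Ξ φ := fun h φ =>
    funext fun j => hs.homeoBD_smul (mu j) (lam j) (h j) (φ j)
  let Θ := flagHomeo mu lam hp hlam
  let Φ := balancedHomeo mu lam hp hs.central hlam
  have hΘ : ∀ (g : U (∑ j, mu j)) X, Θ.symm (g • X) = g • Θ.symm X := fun g X => by
    refine Θ.injective ?_
    rw [Θ.apply_symm_apply, flagHomeo_smul, Θ.apply_symm_apply]
  have hΦ : ∀ (g : U (∑ j, mu j)) f, Φ.symm (g • f) = g • Φ.symm f := fun g f => by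
    refine Φ.injective ?_
    rw [Φ.apply_symm_apply, balancedHomeo_smul, Φ.apply_symm_apply]
  have hres : ∀ f, Θ.symm (res Γ x _ p f) = collapse _ _ (Φ.symm f) := fun f => by
    rw [Θ.symm_apply_eq, flagHomeo_collapse mu lam hp hs.central hlam, Φ.apply_symm_apply]
  have hbundle := isFibreBundle_res mu lam hp hs.central hlam
  refine ⟨⟨Θ.symm, Φ.symm, Φ.symm.trans (BalancedProduct.congr _ Ξ hΞ), hΘ, hΦ, fun g f => ?_,
    hres, fun f => ?_⟩, hbundle, hbundle.congr Ξ, fun k hk hprim hne =>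
      orbitSpace_homeomorph mu lam hp hs hlam k hk hprim hne⟩
  · rw [Homeomorph.trans_apply, hΦ, BalancedProduct.congr_smul, Homeomorph.trans_apply]
  · rw [hres, Homeomorph.trans_apply, BalancedProduct.collapse_congr]
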